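/- For $n\ge 1$ let $g_n(t)=e^{-1/t^{2n}}$ for $t\in\mathbb R\setminus\{0\}$, $g_n(0)=0$, and let $$S_n=\bigcup_{t\in\mathbb R}\{(z,w)\in\mathbb C^2:\ w=t+g_n(t)z\}.$$ A Levi flat hypersurface is a $C^\infty$ real hypersurface foliated by complex curves. A *Levi flat pair* $(S,U)$ in a domain $D\subset\mathbb C^2$ consists of a Levi flat hypersurface $S\subset D$ with $0\in S$, closed in $D$, which divides $D$ into two connected components, each having $S$ in its closure, and of one of these components, $U$. Two pairs $(S_1,U_1)$, $(S_2,U_2)$ are *locally equivalent* if there are open neighborhoods $N_1,N_2$ of $0$ and a biholomorphism $\Phi:N_1\cap U_1\to N_2\cap U_2$ such that $\Phi$ and $\Phi^{-1}$ extend $C^\infty$-smoothly up to the boundary to maps taking $N_1\cap S_1$ into $N_2\cap S_2$ and $N_2\cap S_2$ into $N_1\cap S_1$ respectively, and the extension satisfies $\Phi(0)=0$. (i) For every $n\ge1$, each neighborhood of $0$ contains a domain $D\ni 0$ such that $(S_n\cap D,U)$ is a Levi flat pair in $D$ for some $U$, and $(S_n\cap D)\setminus\{w=0\}$ is a real analytic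 hypersurface. (ii) The germs of the $S_n$ at $0$ are pairwise not locally equivalent: if $n,m\ge1$, $n\ne m$, $D$ is a domain, and $(S_n\cap D,U_1)$, $(S_m\cap D,U_2)$ are Levi flat pairs in $D$ (with either choice of the sides), then $(S_n\cap D,U_1)$ and $(S_m\cap D,U_2)$ are not locally equivalent. -/

import Mathlib

open scoped ContDiff Topology

/-- A (not necessarily closed) embedded real hypersurface of class `C^k` in `ℂ²`, given by local
defining functions with nonvanishing differential. For `k = ω`: a real analytic hypersurface. -/
def IsRealHypersurface (k : WithTop ℕ∞) (S : Set (ℂ × ℂ)) : Prop :=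
  ∀ p ∈ S, ∃ (W : Set (ℂ × ℂ)) (ρ : ℂ × ℂ → ℝ), IsOpen W ∧ p ∈ W ∧
    ContDiffOn ℝ k ρ W ∧ (∀ q ∈ W, fderiv ℝ ρ q ≠ 0) ∧ S ∩ W = {q ∈ W | ρ q = 0}

/-- A Levi flat hypersurface of class `C^k` (`1 ≤ k`) in `ℂ²`: a real hypersurface of class `C^k`
which is foliated by complex curves, i.e. locally it is the bijective image of an immersion
`(ζ, t) ↦ ψ (ζ, t)` of class `C^k` on an open subset of `ℂ × ℝ`, holomorphic in `ζ`. -/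
def IsLeviFlat (k : WithTop ℕ∞) (S : Set (ℂ × ℂ)) : Prop :=
  IsRealHypersurface k S ∧
  ∀ p ∈ S, ∃ (W : Set (ℂ × ℂ)) (Q : Set (ℂ × ℝ)) (ψ : ℂ × ℝ → ℂ × ℂ),
    IsOpen W ∧ p ∈ W ∧ IsOpen Q ∧ ContDiffOn ℝ k ψ Q ∧
    (∀ x ∈ Q, Function.Injective (fderiv ℝ ψ x)) ∧
    (∀ x ∈ Q, DifferentiableAt ℂ (fun ζ : ℂ => ψ (ζ, x.2)) x.1) ∧
    Set.BijOn ψ Q (S ∩ W)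

/-- `(S, U)` is a Levi flat pair of class `C^k` in the domain `D ⊆ ℂ²`: `S` is a Levi flat
hypersurface of class `C^k` through `0`, closed in `D`, which divides `D` in two connected
components (both having all of `S` in their closure), and `U` is one of them. -/
structure IsLeviFlatPair (k : WithTop ℕ∞) (D S U : Set (ℂ × ℂ)) : Prop where
  isOpen_domain : IsOpen D
  isConnected_domain : IsConnected D
  subset_domain : S ⊆ D
  zero_mem : (0 : ℂ × ℂ) ∈ S
  leviFlat : IsLeviFlat k S
  divides : ∃ U' : Set (ℂ × ℂ), IsOpen U ∧ IsOpen U' ∧ IsConnected U ∧ IsConnected U' ∧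
    Disjoint U U' ∧ U ∪ U' = D \ S ∧ S ⊆ closure U ∧ S ⊆ closure U'

/-- `C^k` local equivalence of the germs at `0` of `(S₁, U₁)` and `(S₂, U₂)`: there are open
neighborhoods `N₁`, `N₂` of `0` and a biholomorphism `Φ : N₁ ∩ U₁ → N₂ ∩ U₂` (with inverse `Ψ`)
such that `Φ` and `Ψ` are of class `C^k` up to the boundary pieces `S₁ ∩ N₁`, `S₂ ∩ N₂`, carry
these to one another, and `Φ 0 = 0`. For `1 ≤ k` the boundary maps are automatically CR, and
mutually inverse, by continuity. -/
def LocallyEquivalent (k : WithTop ℕ∞) (S₁ U₁ S₂ U₂ : Set (ℂ × ℂ)) : Prop :=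
  ∃ (N₁ N₂ : Set (ℂ × ℂ)) (Φ Ψ : ℂ × ℂ → ℂ × ℂ),
    IsOpen N₁ ∧ IsOpen N₂ ∧ (0 : ℂ × ℂ) ∈ N₁ ∧ (0 : ℂ × ℂ) ∈ N₂ ∧
    Set.MapsTo Φ (N₁ ∩ U₁) (N₂ ∩ U₂) ∧ Set.MapsTo Ψ (N₂ ∩ U₂) (N₁ ∩ U₁) ∧
    Set.InvOn Ψ Φ (N₁ ∩ U₁) (N₂ ∩ U₂) ∧
    DifferentiableOn ℂ Φ (N₁ ∩ U₁) ∧ DifferentiableOn ℂ Ψ (N₂ ∩ U₂) ∧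
    ContDiffOn ℝ k Φ (N₁ ∩ (U₁ ∪ S₁)) ∧ ContDiffOn ℝ k Ψ (N₂ ∩ (U₂ ∪ S₂)) ∧
    Set.MapsTo Φ (N₁ ∩ S₁) (N₂ ∩ S₂) ∧ Set.MapsTo Ψ (N₂ ∩ S₂) (N₁ ∩ S₁) ∧
    Φ 0 = 0

/-- The flat function `g_n(t) = exp (-1 / t^(2n))`, with `g_n(0) = 0`. -/
noncomputable def flatSlope (n : ℕ) (t : ℝ) : ℝ :=
  if t = 0 then 0 else Real.exp (-1 / t ^ (2 * n))

/-- `S_n`, the union over `t ∈ ℝ` of the complex lines `w = t + g_n(t) z`. -/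
def hypersurfaceS (n : ℕ) : Set (ℂ × ℂ) :=
  {p | ∃ t : ℝ, p.2 = (t : ℂ) + (flatSlope n t : ℂ) * p.1}

-- Part (i) rests on the bound `|g_n'| ≤ 4n`. For `8n|z| < 1` the map `t ↦ t + g_n(t) Re z` is a
-- small Lipschitz perturbation of the identity, so every `(z, w)` has unique coordinates `(z, t,
-- s)` with `w = t + g_n(t) z + i s`. In them `S_n` is `s = 0` and its two sides are the signs of
-- `s`. The coordinates are smooth, and analytic where `t ≠ 0`, which on `S_n` means `w ≠ 0`.
--
-- Part (ii) reads `n` off the slopes of the leaves. Let `Φ` be an equivalence and `A` its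
-- derivative up to the boundary. The leaf through `(0, t)` has direction `(1, g_n(t))`, which `A(0,
-- t)` maps to a multiple of `(1, g_m(τ))`, where `τ = τ(t)` is the parameter of the image leaf
-- (`leaf_derivative_eq`). By linearity, `A(0, t)(1, 0).2` equals `g_m(τ) A(0, t)(1, g_n(t)).1 -
-- g_n(t) A(0, t)(0, 1).2`. Since `A 0` is injective and preserves `w = 0`, `|τ|` is comparable to
-- `|t|`, so this expression is `O(exp(-c/t²))`.
--
-- It is also the boundary value of the function `w ↦ A(0, w)(1, 0).2`, holomorphic on a half disc
-- inside `U`. Decay this fast forces it to vanish (`eqOn_zero_of_flat_boundary_values`). The two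
-- remaining terms are therefore equal, so `g_n(t)` and `g_m(τ)` are comparable up to constants.
-- Taking logarithms gives `n = m` (`exponent_eq_of_flatSlope_comparable`).

-- Bounds for the flat slope functions.

theorem flatSlope_zero (n : ℕ) : flatSlope n 0 = 0 := by simp [flatSlope]

theorem flatSlope_of_ne {n : ℕ} {t : ℝ} (ht : t ≠ 0) :
    flatSlope n t = Real.exp (-1 / t ^ (2 * n)) := by simp [flatSlope, ht]

theorem flatSlope_nonneg (n : ℕ) (t : ℝ) : 0 ≤ flatSlope n t := by
  unfold flatSlope; split_ifs <;> positivity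

theorem flatSlope_eq_expNegInvGlue {n : ℕ} (hn : 1 ≤ n) :
    flatSlope n = fun t => expNegInvGlue (t ^ (2 * n)) := by
  funext t
  by_cases ht : t = 0
  · have : n ≠ 0 := by omega
    simp [ht, flatSlope, this]
  · have h : 0 < t ^ (2 * n) := (even_two_mul n).pow_pos ht
    simp [flatSlope, ht, expNegInvGlue, h.not_ge, neg_div]

theorem contDiff_flatSlope {n : ℕ} (hn : 1 ≤ n) : ContDiff ℝ ∞ (flatSlope n) := by
  rw [flatSlope_eq_expNegInvGlue hn]
  exact expNegInvGlue.contDiff.comp (contDiff_id.pow _)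

theorem contDiffAt_omega_flatSlope (n : ℕ) {t : ℝ} (ht : t ≠ 0) :
    ContDiffAt ℝ ω (flatSlope n) t := by
  have h : ContDiffAt ℝ ω (fun s : ℝ => Real.exp (-1 / s ^ (2 * n))) t :=
    (contDiffAt_const.div (contDiffAt_id (x := t).pow (2 * n)) (pow_ne_zero _ ht)).exp
  refine h.congr_of_eventuallyEq ?_
  filter_upwards [isOpen_ne.mem_nhds ht] with s hs using flatSlope_of_ne hs

/-- With `u = 1/|t|` the derivative has size `2n u^(2n+1) exp(-u^(2n))`. This is at most `2n` for `u
≤ 1`; for `u ≥ 1` and `v = u^(2n)`, use `u^(2n+1) ≤ v² ≤ 2 exp v`. Density of `t ≠ 0` gives the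
bound at `0`. The explicit constant fixes the size `8n|z| ≤ 1` of every later neighborhood. -/
theorem norm_deriv_flatSlope_le {n : ℕ} (hn : 1 ≤ n) (t : ℝ) :
    ‖deriv (flatSlope n) t‖ ≤ 4 * n := by
  have hcont : Continuous fun t => ‖deriv (flatSlope n) t‖ :=
    ((contDiff_flatSlope hn).continuous_deriv (by simp)).norm
  have hne : ∀ s : ℝ, s ≠ 0 → ‖deriv (flatSlope n) s‖ ≤ 4 * n := by
    intro s hs
    have hev : flatSlope n =ᶠ[𝓝 s] fun s => Real.exp (-(s ^ (2 * n))⁻¹) := by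
      filter_upwards [isOpen_ne.mem_nhds hs] with x hx
      rw [flatSlope_of_ne hx, neg_div, one_div]
    have hd : HasDerivAt (fun s : ℝ => Real.exp (-(s ^ (2 * n))⁻¹))
        (Real.exp (-(s ^ (2 * n))⁻¹) *
          (-(-(((2 * n : ℕ) : ℝ) * s ^ (2 * n - 1)) / (s ^ (2 * n)) ^ 2))) s :=
      (((hasDerivAt_pow (2 * n) s).inv (pow_ne_zero _ hs)).neg).exp
    rw [hev.deriv_eq, hd.deriv]
    set u : ℝ := |s|⁻¹ with hu
    have hu0 : 0 < u := by positivity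
    have hpow : (s ^ (2 * n))⁻¹ = u ^ (2 * n) := by
      rw [hu, inv_pow, (even_two_mul n).pow_abs]
    have hval : ‖Real.exp (-(s ^ (2 * n))⁻¹) *
          (-(-(((2 * n : ℕ) : ℝ) * s ^ (2 * n - 1)) / (s ^ (2 * n)) ^ 2))‖ =
        2 * n * (u ^ (2 * n + 1) * Real.exp (-u ^ (2 * n))) := by
      obtain ⟨k, hk⟩ : ∃ k, 2 * n = k + 1 := ⟨2 * n - 1, by omega⟩
      rw [hpow]
      simp only [norm_mul, norm_neg, norm_div, norm_pow, Real.norm_eq_abs, Real.abs_exp,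
        Nat.abs_cast, Nat.cast_mul, Nat.cast_ofNat, abs_two]
      have hs' : |s| ≠ 0 := abs_ne_zero.2 hs
      rw [hk, hu]
      simp only [Nat.add_sub_cancel]
      have : (|s| ^ (k + 1)) ^ 2 = |s| ^ k * |s| ^ (k + 1 + 1) := by ring
      simp only [this, inv_pow]
      field_simp
    rw [hval]
    have hE := Real.exp_pos (-u ^ (2 * n))
    have key : u ^ (2 * n + 1) * Real.exp (-u ^ (2 * n)) ≤ 2 := by
      rcases le_total u 1 with h1 | h1
      · have a : u ^ (2 * n + 1) ≤ 1 := pow_le_one₀ hu0.le h1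
        have b : Real.exp (-u ^ (2 * n)) ≤ 1 := Real.exp_le_one_iff.2 (by
          have : 0 < u ^ (2 * n) := by positivity
          linarith)
        nlinarith
      · set v := u ^ (2 * n) with hv
        have hv0 : 0 ≤ v := by positivity
        have a : u ^ (2 * n + 1) ≤ v ^ 2 := by
          rw [hv, ← pow_mul]; exact pow_le_pow_right₀ h1 (by omega)
        have b := Real.quadratic_le_exp_of_nonneg hv0
        have c : v ^ 2 * Real.exp (-v) ≤ 2 := by
          rw [Real.exp_neg, ← div_eq_mul_inv, div_le_iff₀ (Real.exp_pos v)]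
          nlinarith
        exact (mul_le_mul_of_nonneg_right a hE.le).trans c
    have : (0 : ℝ) ≤ n := Nat.cast_nonneg n
    nlinarith
  exact (isClosed_le hcont continuous_const).closure_subset_iff.2 hne
    (dense_compl_singleton (0 : ℝ) t)

theorem flatSlope_lipschitz {n : ℕ} (hn : 1 ≤ n) (s t : ℝ) :
    |flatSlope n s - flatSlope n t| ≤ 4 * n * |s - t| := by
  have := Convex.norm_image_sub_le_of_norm_deriv_le (f := flatSlope n) (s := Set.univ)
    (C := 4 * n) (x := t) (y := s)
    (fun x _ => ((contDiff_flatSlope hn).differentiable (by simp)).differentiableAt)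
    (fun x _ => norm_deriv_flatSlope_le hn x) convex_univ (Set.mem_univ _) (Set.mem_univ _)
  simpa [Real.norm_eq_abs] using this

theorem flatSlope_le_mul_abs {n : ℕ} (hn : 1 ≤ n) (t : ℝ) :
    flatSlope n t ≤ 4 * n * |t| := by
  have := flatSlope_lipschitz hn t 0
  rwa [flatSlope_zero, sub_zero, sub_zero, abs_of_nonneg (flatSlope_nonneg n t)] at this

theorem flatSlope_le_one (n : ℕ) (t : ℝ) : flatSlope n t ≤ 1 := by
  unfold flatSlope
  split_ifs
  · norm_num
  · exact Real.exp_le_one_iff.2 (div_nonpos_of_nonpos_of_nonneg (by norm_num)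
      ((even_two_mul n).pow_nonneg t))

/-- A decay rate common to all exponents, so that one uniqueness lemma on the half disc serves both
`g_n` and `g_m`. -/
theorem flatSlope_le_exp_neg_inv_sq {n : ℕ} (hn : 1 ≤ n) {t : ℝ} (h0 : t ≠ 0) (h1 : |t| ≤ 1) :
    flatSlope n t ≤ Real.exp (-1 / t ^ 2) := by
  rw [flatSlope_of_ne h0, Real.exp_le_exp, neg_div, neg_div, neg_le_neg_iff]
  refine one_div_le_one_div_of_le ((even_two_mul n).pow_pos h0) ?_
  rw [← (even_two_mul n).pow_abs, ← sq_abs t]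
  exact pow_le_pow_of_le_one (abs_nonneg t) h1 (by omega)

-- The leaf parameter as an inverse function.

theorem exists_leaf_param {n : ℕ} (hn : 1 ≤ n) (x u : ℝ) : ∃ t : ℝ, t + flatSlope n t * x = u := by
  have hc : Continuous fun t : ℝ => t + flatSlope n t * x :=
    continuous_id.add ((contDiff_flatSlope hn).continuous.mul continuous_const)
  have hb : ∀ t, |flatSlope n t * x| ≤ |x| := fun t => by
    rw [abs_mul, abs_of_nonneg (flatSlope_nonneg n t)]
    exact mul_le_of_le_one_left (abs_nonneg x) (flatSlope_le_one n t)
  have h1 : u - |x| + flatSlope n (u - |x|) * x ≤ u := by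
    linarith [le_abs_self (flatSlope n (u - |x|) * x), hb (u - |x|)]
  have h2 : u ≤ u + |x| + flatSlope n (u + |x|) * x := by
    linarith [neg_abs_le (flatSlope n (u + |x|) * x), hb (u + |x|)]
  exact mem_range_of_exists_le_of_exists_ge hc ⟨_, h1⟩ ⟨_, h2⟩

open Classical in
/-- A solution `t` of `t + g_n(t) x = u`. -/
noncomputable def leafParam (n : ℕ) (x u : ℝ) : ℝ :=
  if h : ∃ t : ℝ, t + flatSlope n t * x = u then h.choose else 0

theorem leafParam_spec {n : ℕ} (hn : 1 ≤ n) (x u : ℝ) :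
    leafParam n x u + flatSlope n (leafParam n x u) * x = u := by
  have h := exists_leaf_param hn x u
  unfold leafParam
  rw [dif_pos h]
  exact h.choose_spec

/-- The perturbation `t ↦ g_n(t) x` has Lipschitz constant `4n|x| ≤ 1/2`. This gives uniqueness and
continuity of the leaf parameter. -/
theorem abs_sub_le_two_mul {n : ℕ} (hn : 1 ≤ n) {x : ℝ} (hx : 8 * n * |x| ≤ 1) (s t : ℝ) :
    |s - t| ≤ 2 * |(s + flatSlope n s * x) - (t + flatSlope n t * x)| := by
  have h1 : |(flatSlope n s - flatSlope n t) * x| ≤ |s - t| / 2 := by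
    rw [abs_mul]
    have := mul_le_mul_of_nonneg_right (flatSlope_lipschitz hn s t) (abs_nonneg x)
    nlinarith [abs_nonneg (s - t)]
  have h2 : s - t = ((s + flatSlope n s * x) - (t + flatSlope n t * x)) -
      (flatSlope n s - flatSlope n t) * x := by ring
  have h3 := abs_sub ((s + flatSlope n s * x) - (t + flatSlope n t * x))
    ((flatSlope n s - flatSlope n t) * x)
  rw [← h2] at h3
  linarith

theorem leafParam_unique {n : ℕ} (hn : 1 ≤ n) {x u t : ℝ} (hx : 8 * n * |x| ≤ 1)
    (h : t + flatSlope n t * x = u) : leafParam n x u = t := by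
  have := abs_sub_le_two_mul hn hx (leafParam n x u) t
  rw [leafParam_spec hn, h, sub_self, abs_zero, mul_zero] at this
  exact sub_eq_zero.1 (abs_nonpos_iff.1 this)

theorem continuousAt_leafParam {n : ℕ} (hn : 1 ≤ n) {q : ℝ × ℝ} (hx : 8 * n * |q.1| < 1) :
    ContinuousAt (fun p : ℝ × ℝ => leafParam n p.1 p.2) q := by
  rw [ContinuousAt, tendsto_iff_dist_tendsto_zero]
  have hlim : Filter.Tendsto (fun p : ℝ × ℝ => 2 * (|p.2 - q.2| + |p.1 - q.1|)) (𝓝 q) (𝓝 0) := by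
    have : ContinuousAt (fun p : ℝ × ℝ => 2 * (|p.2 - q.2| + |p.1 - q.1|)) q := by fun_prop
    simpa [ContinuousAt] using this
  refine squeeze_zero (fun _ => dist_nonneg) (fun p => ?_) hlim
  set s := leafParam n p.1 p.2
  have h1 := leafParam_spec hn p.1 p.2
  have h2 := leafParam_spec hn q.1 q.2
  have h3 := abs_sub_le_two_mul hn hx.le s (leafParam n q.1 q.2)
  rw [h2] at h3
  rw [Real.dist_eq]
  refine h3.trans (mul_le_mul_of_nonneg_left ?_ two_pos.le)
  have h4 : s + flatSlope n s * q.1 - q.2 = (p.2 - q.2) - flatSlope n s * (p.1 - q.1) := by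
    rw [← h1]; ring
  rw [h4]
  refine (abs_sub _ _).trans (add_le_add le_rfl ?_)
  rw [abs_mul, abs_of_nonneg (flatSlope_nonneg n s)]
  exact mul_le_of_le_one_left (abs_nonneg _) (flatSlope_le_one n s)

theorem one_add_deriv_mul_ne_zero {n : ℕ} (hn : 1 ≤ n) {x : ℝ} (hx : 8 * n * |x| < 1) (t : ℝ) :
    1 + deriv (flatSlope n) t * x ≠ 0 := by
  intro h
  have h1 := mul_le_mul_of_nonneg_right (norm_deriv_flatSlope_le hn t) (abs_nonneg x)
  rw [Real.norm_eq_abs, ← abs_mul, show deriv (flatSlope n) t * x = -1 by linarith] at h1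
  norm_num at h1
  linarith

/-- The homeomorphism `(x, t) ↦ (x, t + g_n(t) x)` of a vertical strip. -/
noncomputable def stripHomeomorph (n : ℕ) (hn : 1 ≤ n) : OpenPartialHomeomorph (ℝ × ℝ) (ℝ × ℝ) where
  toFun p := (p.1, p.2 + flatSlope n p.2 * p.1)
  invFun p := (p.1, leafParam n p.1 p.2)
  source := {p | 8 * n * |p.1| < 1}
  target := {p | 8 * n * |p.1| < 1}
  map_source' _ h := h
  map_target' _ h := h
  left_inv' p h := Prod.ext rfl (leafParam_unique hn (le_of_lt h) rfl)
  right_inv' p _ := Prod.ext rfl (leafParam_spec hn p.1 p.2)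
  open_source := isOpen_lt (by fun_prop) continuous_const
  open_target := isOpen_lt (by fun_prop) continuous_const
  continuousOn_toFun := by
    have := (contDiff_flatSlope hn).continuous
    fun_prop
  continuousOn_invFun p hp :=
    (continuousAt_fst.prodMk (continuousAt_leafParam hn hp)).continuousWithinAt

/-- Inverse function theorem for `(x, t) ↦ (x, t + g_n(t) x)`. The order `k` is left free to cover
both `∞` everywhere and `ω` away from `t = 0`. -/
theorem contDiffAt_leafParam {n : ℕ} (hn : 1 ≤ n) {k : WithTop ℕ∞} {q : ℝ × ℝ}
    (hx : 8 * n * |q.1| < 1) (hk : ContDiffAt ℝ k (flatSlope n) (leafParam n q.1 q.2)) :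
    ContDiffAt ℝ k (fun p : ℝ × ℝ => leafParam n p.1 p.2) q := by
  set t := leafParam n q.1 q.2 with ht
  have hg : HasDerivAt (flatSlope n) (deriv (flatSlope n) t) t :=
    ((contDiff_flatSlope hn).differentiable (by simp) t).hasDerivAt
  have hg' := hg.comp_hasFDerivAt_of_eq ((q.1, t) : ℝ × ℝ)
    (hasFDerivAt_snd (𝕜 := ℝ) (p := ((q.1, t) : ℝ × ℝ))) rfl
  have hd := (hasFDerivAt_fst (𝕜 := ℝ) (p := ((q.1, t) : ℝ × ℝ))).prodMk
    ((hasFDerivAt_snd (𝕜 := ℝ) (p := ((q.1, t) : ℝ × ℝ))).add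
      (hg'.mul (hasFDerivAt_fst (𝕜 := ℝ) (p := ((q.1, t) : ℝ × ℝ)))))
  set A := (ContinuousLinearMap.fst ℝ ℝ ℝ).prod (ContinuousLinearMap.snd ℝ ℝ ℝ +
    ((flatSlope n ∘ Prod.snd) ((q.1, t) : ℝ × ℝ) • ContinuousLinearMap.fst ℝ ℝ ℝ +
      ((q.1, t) : ℝ × ℝ).1 • deriv (flatSlope n) t • ContinuousLinearMap.snd ℝ ℝ ℝ)) with hA
  have hker : A.ker = ⊥ := by
    rw [LinearMap.ker_eq_bot']
    rintro ⟨a, b⟩ h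
    have h1 : a = 0 := congrArg Prod.fst h
    have h2 : b + (flatSlope n t * a + q.1 * (deriv (flatSlope n) t * b)) = 0 := congrArg Prod.snd h
    subst h1
    have h3 : (1 + deriv (flatSlope n) t * q.1) * b = 0 := by linarith
    exact Prod.ext rfl ((mul_eq_zero.1 h3).resolve_left (one_add_deriv_mul_ne_zero hn hx t))
  have hrange : A.range = ⊤ := LinearMap.ker_eq_bot_iff_range_eq_top.1 hker
  have hsymm : ContDiffAt ℝ k (stripHomeomorph n hn).symm q := by
    refine (stripHomeomorph n hn).contDiffAt_symm
      (f₀' := ContinuousLinearEquiv.ofBijective A hker hrange) hx ?_ ?_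
    · rw [ContinuousLinearEquiv.coe_ofBijective]
      exact hd
    · have h1 : ContDiffAt ℝ k (fun p : ℝ × ℝ => flatSlope n p.2) (q.1, t) :=
        ContDiffAt.comp (g := flatSlope n) (q.1, t) hk contDiffAt_snd
      exact contDiffAt_fst.prodMk (contDiffAt_snd.add (h1.mul contDiffAt_fst))
  exact contDiffAt_snd.comp q hsymm

-- Coordinates flattening `S_n`.

/-- The parameter of the leaf of `S_n`, translated in the direction of the imaginary part of `w`,
through a point. -/
noncomputable def leafCoord (n : ℕ) (p : ℂ × ℂ) : ℝ := leafParam n p.1.re p.2.re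

/-- The defining function of `S_n`. -/
noncomputable def definingFunction (n : ℕ) (p : ℂ × ℂ) : ℝ :=
  p.2.im - flatSlope n (leafCoord n p) * p.1.im

/-- Coordinates `(z, t, s)` in which `S_n` is `s = 0` and its leaves are `t = const`. -/
noncomputable def flatChart (n : ℕ) (x : ℂ × ℝ × ℝ) : ℂ × ℂ :=
  (x.1, x.2.1 + flatSlope n x.2.1 * x.1 + x.2.2 * Complex.I)

theorem leafCoord_flatChart {n : ℕ} (hn : 1 ≤ n) {x : ℂ × ℝ × ℝ} (hx : 8 * n * ‖x.1‖ ≤ 1) :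
    leafCoord n (flatChart n x) = x.2.1 := by
  refine leafParam_unique hn (le_trans ?_ hx) (by simp [flatChart])
  gcongr
  exact Complex.abs_re_le_norm _

theorem definingFunction_flatChart {n : ℕ} (hn : 1 ≤ n) {x : ℂ × ℝ × ℝ} (hx : 8 * n * ‖x.1‖ ≤ 1) :
    definingFunction n (flatChart n x) = x.2.2 := by
  rw [definingFunction, leafCoord_flatChart hn hx]
  simp [flatChart]

theorem flatChart_coords {n : ℕ} (hn : 1 ≤ n) (p : ℂ × ℂ) :
    flatChart n (p.1, leafCoord n p, definingFunction n p) = p := by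
  refine Prod.ext rfl (Complex.ext ?_ ?_)
  · simpa [flatChart, leafCoord] using leafParam_spec hn p.1.re p.2.re
  · simp [flatChart, definingFunction]

theorem mem_hypersurfaceS_iff {n : ℕ} (hn : 1 ≤ n) {p : ℂ × ℂ} (hp : 8 * n * ‖p.1‖ ≤ 1) :
    p ∈ hypersurfaceS n ↔ definingFunction n p = 0 := by
  constructor
  · rintro ⟨t, ht⟩
    have : p = flatChart n (p.1, t, 0) := Prod.ext rfl (by simp [flatChart, ht])
    rw [this, definingFunction_flatChart hn hp]
  · intro h
    have := flatChart_coords hn p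
    rw [h] at this
    refine ⟨leafCoord n p, ?_⟩
    nth_rw 1 [← this]
    simp [flatChart]

theorem contDiffAt_leafCoord {n : ℕ} (hn : 1 ≤ n) {k : WithTop ℕ∞} {p : ℂ × ℂ}
    (hp : 8 * n * ‖p.1‖ < 1) (hk : ContDiffAt ℝ k (flatSlope n) (leafCoord n p)) :
    ContDiffAt ℝ k (leafCoord n) p := by
  have h1 : ContDiffAt ℝ k (fun p : ℂ × ℂ => (p.1.re, p.2.re)) p :=
    (Complex.reCLM.contDiff.contDiffAt.comp p contDiffAt_fst).prodMk
      (Complex.reCLM.contDiff.contDiffAt.comp p contDiffAt_snd)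
  have h2 : 8 * n * |p.1.re| < 1 := lt_of_le_of_lt (by
    gcongr
    exact Complex.abs_re_le_norm _) hp
  exact ContDiffAt.comp (g := fun q : ℝ × ℝ => leafParam n q.1 q.2) p
    (contDiffAt_leafParam hn (q := (p.1.re, p.2.re)) h2 hk) h1

theorem contDiffAt_definingFunction {n : ℕ} (hn : 1 ≤ n) {k : WithTop ℕ∞} {p : ℂ × ℂ}
    (hp : 8 * n * ‖p.1‖ < 1) (hk : ContDiffAt ℝ k (flatSlope n) (leafCoord n p)) :
    ContDiffAt ℝ k (definingFunction n) p :=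
  (Complex.imCLM.contDiff.contDiffAt.comp p contDiffAt_snd).sub
    ((hk.comp p (contDiffAt_leafCoord hn hp hk)).mul
      (Complex.imCLM.contDiff.contDiffAt.comp p contDiffAt_fst))

/-- Only real parts of `z` and `w` enter the leaf parameter, so moving `Im w` changes `s` alone.
This shows that the differential is nonzero and that both sides accumulate at each point of `S_n`.
-/
theorem definingFunction_add_vertical (n : ℕ) (p : ℂ × ℂ) (s : ℝ) :
    definingFunction n (p + s • ((0, Complex.I) : ℂ × ℂ)) = definingFunction n p + s := by
  simp [definingFunction, leafCoord]
  ring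

theorem leafCoord_add_vertical (n : ℕ) (p : ℂ × ℂ) (s : ℝ) :
    leafCoord n (p + s • ((0, Complex.I) : ℂ × ℂ)) = leafCoord n p := by
  simp [leafCoord]

theorem fderiv_definingFunction_ne_zero {n : ℕ} (hn : 1 ≤ n) {p : ℂ × ℂ}
    (hp : 8 * n * ‖p.1‖ < 1) : fderiv ℝ (definingFunction n) p ≠ 0 := by
  have hd : HasFDerivAt (definingFunction n) (fderiv ℝ (definingFunction n) p) p :=
    ((contDiffAt_definingFunction hn hp
      (contDiff_flatSlope hn).contDiffAt).differentiableAt (by simp)).hasFDerivAt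
  have h1 := hd.hasLineDerivAt ((0, Complex.I) : ℂ × ℂ)
  have h2 : HasLineDerivAt ℝ (definingFunction n) 1 p ((0, Complex.I) : ℂ × ℂ) := by
    unfold HasLineDerivAt
    simp only [definingFunction_add_vertical]
    exact (hasDerivAt_id (0 : ℝ)).const_add _
  intro h0
  rw [h0] at h1
  exact one_ne_zero (h2.unique h1)

-- Flat boxes as domains for part (i).

/-- The box `|z| < r`, `|t| < r`, `a < s < b` in flat coordinates. -/
def flatBox (n : ℕ) (r a b : ℝ) : Set (ℂ × ℂ) :=
  {p | ‖p.1‖ < r ∧ |leafCoord n p| < r ∧ a < definingFunction n p ∧ definingFunction n p < b}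

section FlatBox

variable {n : ℕ} {r a b : ℝ}

theorem lt_one_of_mem_flatBox (hn : 1 ≤ n) (hr : 8 * n * r ≤ 1) {p : ℂ × ℂ}
    (hp : p ∈ flatBox n r a b) : 8 * n * ‖p.1‖ < 1 := by
  have h1 := hp.1
  have : (0 : ℝ) < n := by exact_mod_cast hn
  exact (mul_lt_mul_of_pos_left h1 (by positivity)).trans_le hr

theorem isOpen_flatBox (hn : 1 ≤ n) (hr : 8 * n * r ≤ 1) : IsOpen (flatBox n r a b) := by
  rw [isOpen_iff_mem_nhds]
  intro p hp
  have hp' := lt_one_of_mem_flatBox hn hr hp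
  have hg : ContDiffAt ℝ ∞ (flatSlope n) (leafCoord n p) := (contDiff_flatSlope hn).contDiffAt
  have c1 := (contDiffAt_leafCoord hn hp' hg).continuousAt
  have c2 := (contDiffAt_definingFunction hn hp' hg).continuousAt
  obtain ⟨h1, h2, h3, h4⟩ := hp
  filter_upwards [(continuous_fst.norm (E := ℂ)).continuousAt.eventually_lt_const h1,
    c1.abs.eventually_lt_const h2, c2.eventually_const_lt h3, c2.eventually_lt_const h4]
    with q q1 q2 q3 q4 using ⟨q1, q2, q3, q4⟩

theorem flatBox_eq_image (hn : 1 ≤ n) (hr : 8 * n * r ≤ 1) :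
    flatBox n r a b =
      flatChart n '' (Metric.ball 0 r ×ˢ (Set.Ioo (-r) r ×ˢ Set.Ioo a b)) := by
  ext p
  constructor
  · rintro ⟨h1, h2, h3, h4⟩
    exact ⟨(p.1, leafCoord n p, definingFunction n p),
      ⟨by simpa using h1, abs_lt.1 h2, h3, h4⟩, flatChart_coords hn p⟩
  · rintro ⟨x, ⟨h1, h2, h3, h4⟩, rfl⟩
    have h1' : ‖x.1‖ < r := by simpa using h1
    have hx : 8 * n * ‖x.1‖ ≤ 1 := le_trans (by gcongr) hr
    refine ⟨h1', ?_, ?_⟩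
    · rw [leafCoord_flatChart hn hx]; exact abs_lt.2 h2
    · rw [definingFunction_flatChart hn hx]; exact ⟨h3, h4⟩

theorem continuous_flatChart (hn : 1 ≤ n) : Continuous (flatChart n) := by
  have := (contDiff_flatSlope hn).continuous
  unfold flatChart
  fun_prop

theorem isConnected_flatBox (hn : 1 ≤ n) (hr0 : 0 < r) (hr : 8 * n * r ≤ 1) (hab : a < b) :
    IsConnected (flatBox n r a b) := by
  rw [flatBox_eq_image hn hr]
  refine ⟨Set.Nonempty.image _ ⟨(0, 0, (a + b) / 2), by simpa using hr0, by simpa using hr0,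
    by dsimp; constructor <;> linarith⟩,
    IsPreconnected.image ?_ _ (continuous_flatChart hn).continuousOn⟩
  exact ((convex_ball 0 r).prod ((convex_Ioo _ _).prod (convex_Ioo _ _))).isPreconnected

theorem isRealHypersurface_inter_flatBox (hn : 1 ≤ n) (hr : 8 * n * r ≤ 1) :
    IsRealHypersurface ∞ (hypersurfaceS n ∩ flatBox n r a b) := by
  rintro p ⟨-, hp⟩
  refine ⟨flatBox n r a b, definingFunction n, isOpen_flatBox hn hr, hp, fun q hq => ?_,
    fun q hq => fderiv_definingFunction_ne_zero hn (lt_one_of_mem_flatBox hn hr hq), ?_⟩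
  · exact (contDiffAt_definingFunction hn (lt_one_of_mem_flatBox hn hr hq)
      (contDiff_flatSlope hn).contDiffAt).contDiffWithinAt
  · ext q
    constructor
    · rintro ⟨⟨h1, -⟩, h2⟩
      exact ⟨h2, (mem_hypersurfaceS_iff hn (lt_one_of_mem_flatBox hn hr h2).le).1 h1⟩
    · rintro ⟨h2, h1⟩
      exact ⟨⟨(mem_hypersurfaceS_iff hn (lt_one_of_mem_flatBox hn hr h2).le).2 h1, h2⟩, h2⟩

theorem snd_eq_of_definingFunction_eq_zero (hn : 1 ≤ n) {p : ℂ × ℂ}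
    (h : definingFunction n p = 0) :
    p.2 = leafCoord n p + flatSlope n (leafCoord n p) * p.1 := by
  have := flatChart_coords hn p
  rw [h] at this
  nth_rw 1 [← this]
  simp [flatChart]

theorem isRealHypersurface_omega_inter_flatBox_diff (hn : 1 ≤ n) (hr : 8 * n * r ≤ 1) :
    IsRealHypersurface ω ((hypersurfaceS n ∩ flatBox n r a b) \ {p : ℂ × ℂ | p.2 = 0}) := by
  -- On `S_n` inside the box, `w = 0` forces `t = 0`, because `|g_n(t) z| ≤ 4n|t||z| < |t|` for `t ≠
  -- 0`. Analyticity of `g_n` thus fails only where it may.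
  have hmem : ∀ q ∈ flatBox n r a b, definingFunction n q = 0 →
      (leafCoord n q ≠ 0 ↔ q.2 ≠ 0) := by
    intro q hq h0
    have hq1 := lt_one_of_mem_flatBox hn hr hq
    rw [snd_eq_of_definingFunction_eq_zero hn h0]
    set t := leafCoord n q
    refine not_congr ⟨fun h => by simp [h, flatSlope_zero], fun h => ?_⟩
    by_contra ht
    have h1 : |t| = flatSlope n t * ‖q.1‖ := by
      have := congrArg norm (eq_neg_of_add_eq_zero_left h)
      rwa [norm_neg, norm_mul, Complex.norm_real, Complex.norm_real, Real.norm_eq_abs,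
        Real.norm_eq_abs, abs_of_nonneg (flatSlope_nonneg n t)] at this
    have h2 := mul_le_mul_of_nonneg_right (flatSlope_le_mul_abs hn t) (norm_nonneg q.1)
    have h3 : 0 < |t| := abs_pos.2 ht
    nlinarith
  rintro p ⟨⟨hpS, hp⟩, hp0⟩
  have hc : ∀ q ∈ flatBox n r a b, ContinuousAt (leafCoord n) q := fun q hq =>
    (contDiffAt_leafCoord hn (lt_one_of_mem_flatBox hn hr hq)
      (contDiff_flatSlope hn).contDiffAt).continuousAt
  refine ⟨{q ∈ flatBox n r a b | leafCoord n q ≠ 0}, definingFunction n, ?_, ⟨hp, ?_⟩,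
    fun q hq => ?_,
    fun q hq => fderiv_definingFunction_ne_zero hn (lt_one_of_mem_flatBox hn hr hq.1), ?_⟩
  · rw [isOpen_iff_mem_nhds]
    rintro q ⟨hq, hq0⟩
    filter_upwards [(isOpen_flatBox hn hr).mem_nhds hq, (hc q hq).eventually_ne hq0]
      with x h1 h2 using ⟨h1, h2⟩
  · exact (hmem p hp ((mem_hypersurfaceS_iff hn (lt_one_of_mem_flatBox hn hr hp).le).1 hpS)).2 hp0
  · exact (contDiffAt_definingFunction hn (lt_one_of_mem_flatBox hn hr hq.1)
      (contDiffAt_omega_flatSlope n hq.2)).contDiffWithinAt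
  · ext q
    constructor
    · rintro ⟨⟨⟨h1, -⟩, -⟩, h2⟩
      exact ⟨h2, (mem_hypersurfaceS_iff hn (lt_one_of_mem_flatBox hn hr h2.1).le).1 h1⟩
    · rintro ⟨h2, h1⟩
      exact ⟨⟨⟨(mem_hypersurfaceS_iff hn (lt_one_of_mem_flatBox hn hr h2.1).le).2 h1, h2.1⟩,
        (hmem q h2.1 h1).1 h2.2⟩, h2⟩

theorem isLeviFlat_inter_flatBox (hn : 1 ≤ n) (hr : 8 * n * r ≤ 1) (ha : a < 0) (hb : 0 < b) :
    IsLeviFlat ∞ (hypersurfaceS n ∩ flatBox n r a b) := by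
  refine ⟨isRealHypersurface_inter_flatBox hn hr, ?_⟩
  rintro p ⟨-, hp⟩
  have hlt : ∀ x : ℂ × ℝ, x ∈ Metric.ball (0 : ℂ) r ×ˢ Set.Ioo (-r) r → 8 * n * ‖x.1‖ < 1 := by
    rintro x ⟨h1, -⟩
    have h1' : ‖x.1‖ < r := by simpa using h1
    have : (0 : ℝ) < n := by exact_mod_cast hn
    exact (mul_lt_mul_of_pos_left h1' (by positivity)).trans_le hr
  refine ⟨flatBox n r a b, Metric.ball 0 r ×ˢ Set.Ioo (-r) r,
    fun x => (x.1, x.2 + flatSlope n x.2 * x.1), isOpen_flatBox hn hr, hp,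
    Metric.isOpen_ball.prod isOpen_Ioo, ?_, ?_, ?_, ?_⟩
  · have h1 : ContDiff ℝ ∞ fun x : ℂ × ℝ => ((flatSlope n x.2 : ℝ) : ℂ) :=
      Complex.ofRealCLM.contDiff.comp ((contDiff_flatSlope hn).comp contDiff_snd)
    have h2 : ContDiff ℝ ∞ fun x : ℂ × ℝ => (x.2 : ℂ) := Complex.ofRealCLM.contDiff.comp contDiff_snd
    exact (contDiff_fst.prodMk (h2.add (h1.mul contDiff_fst))).contDiffOn
  · intro x hx
    have hg : HasDerivAt (flatSlope n) (deriv (flatSlope n) x.2) x.2 :=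
      ((contDiff_flatSlope hn).differentiable (by simp) x.2).hasDerivAt
    have hgc : HasFDerivAt (fun y : ℂ × ℝ => ((flatSlope n y.2 : ℝ) : ℂ)) _ x :=
      Complex.ofRealCLM.hasFDerivAt.comp x
        (hg.comp_hasFDerivAt_of_eq x (hasFDerivAt_snd (𝕜 := ℝ) (p := x)) rfl)
    have hd := (hasFDerivAt_fst (𝕜 := ℝ) (p := x)).prodMk
      ((Complex.ofRealCLM.hasFDerivAt.comp x (hasFDerivAt_snd (𝕜 := ℝ) (p := x))).add
        (hgc.mul (hasFDerivAt_fst (𝕜 := ℝ) (p := x))))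
    have hd' : HasFDerivAt (fun x : ℂ × ℝ => (x.1, (x.2 : ℂ) + flatSlope n x.2 * x.1)) _ x := hd
    rw [hd'.fderiv]
    rw [injective_iff_map_eq_zero]
    rintro ⟨u, v⟩ h
    have h1 : u = 0 := congrArg Prod.fst h
    have h2 := congrArg Prod.snd h
    subst h1
    simp at h2
    have h3 : v + x.1.re * (deriv (flatSlope n) x.2 * v) = 0 := by
      have := congrArg Complex.re h2
      simpa using this
    have hx' : 8 * n * |x.1.re| < 1 := lt_of_le_of_lt (by
      gcongr
      exact Complex.abs_re_le_norm _) (hlt x hx)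
    have h4 : (1 + deriv (flatSlope n) x.2 * x.1.re) * v = 0 := by linarith
    exact Prod.ext rfl ((mul_eq_zero.1 h4).resolve_left (one_add_deriv_mul_ne_zero hn hx' x.2))
  · intro x _
    dsimp only
    fun_prop
  · have heq : ∀ x : ℂ × ℝ, ((x.1, (x.2 : ℂ) + flatSlope n x.2 * x.1) : ℂ × ℂ) =
        flatChart n (x.1, x.2, 0) := fun x => by simp [flatChart]
    refine ⟨fun x hx => ?_, fun x hx y hy hxy => ?_, fun q hq => ?_⟩
    · have hb' : ((x.1, (x.2 : ℂ) + flatSlope n x.2 * x.1) : ℂ × ℂ) ∈ flatBox n r a b := by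
        rw [flatBox_eq_image hn hr, heq]
        exact ⟨_, ⟨hx.1, hx.2, ha, hb⟩, rfl⟩
      exact ⟨⟨⟨x.2, rfl⟩, hb'⟩, hb'⟩
    · simp only [heq] at hxy
      have h1 : x.1 = y.1 := congrArg (fun q : ℂ × ℂ => q.1) hxy
      have h2 := congrArg (leafCoord n) hxy
      rw [leafCoord_flatChart hn (hlt x hx).le, leafCoord_flatChart hn (hlt y hy).le] at h2
      exact Prod.ext h1 h2
    · obtain ⟨⟨hqS, hq⟩, -⟩ := hq
      have h0 := (mem_hypersurfaceS_iff hn (lt_one_of_mem_flatBox hn hr hq).le).1 hqS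
      refine ⟨(q.1, leafCoord n q), ⟨by simpa using hq.1, abs_lt.1 hq.2.1⟩, ?_⟩
      exact Prod.ext rfl (snd_eq_of_definingFunction_eq_zero hn h0).symm

theorem isLeviFlatPair_flatBox (hn : 1 ≤ n) (hr0 : 0 < r) (hr : 8 * n * r ≤ 1) :
    IsLeviFlatPair ∞ (flatBox n r (-r) r) (hypersurfaceS n ∩ flatBox n r (-r) r)
      (flatBox n r 0 r) where
  isOpen_domain := isOpen_flatBox hn hr
  isConnected_domain := isConnected_flatBox hn hr0 hr (by linarith)
  subset_domain := Set.inter_subset_right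
  zero_mem := by
    have h : (0 : ℂ × ℂ) = flatChart n (0, 0, 0) := by simp [flatChart, flatSlope_zero]; rfl
    refine ⟨⟨0, by simp⟩, ?_⟩
    rw [flatBox_eq_image hn hr, h]
    exact ⟨_, ⟨by simpa using hr0, by simpa using hr0, by simpa using hr0⟩, rfl⟩
  leviFlat := isLeviFlat_inter_flatBox hn hr (by linarith) hr0
  divides := by
    have hcl : ∀ c d : ℝ, (∃ᶠ s in 𝓝 (0 : ℝ), c < s ∧ s < d) →
        hypersurfaceS n ∩ flatBox n r (-r) r ⊆ closure (flatBox n r c d) := by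
      rintro c d hfreq p ⟨hpS, hp⟩
      have h0 := (mem_hypersurfaceS_iff hn (lt_one_of_mem_flatBox hn hr hp).le).1 hpS
      have hc : Filter.Tendsto (fun s : ℝ => p + s • ((0, Complex.I) : ℂ × ℂ)) (𝓝 0) (𝓝 p) := by
        have : Continuous fun s : ℝ => p + s • ((0, Complex.I) : ℂ × ℂ) := by fun_prop
        simpa using this.tendsto 0
      refine mem_closure_of_frequently_of_tendsto (hfreq.mono fun s hs => ?_) hc
      refine ⟨by simpa using hp.1, ?_, ?_⟩
      · rw [leafCoord_add_vertical]; exact hp.2.1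
      · rw [definingFunction_add_vertical, h0, zero_add]; exact hs
    refine ⟨flatBox n r (-r) 0, isOpen_flatBox hn hr, isOpen_flatBox hn hr,
      isConnected_flatBox hn hr0 hr hr0, isConnected_flatBox hn hr0 hr (by linarith), ?_, ?_, ?_, ?_⟩
    · rw [Set.disjoint_left]
      rintro p ⟨-, -, h1, -⟩ ⟨-, -, -, h2⟩
      exact lt_asymm h1 h2
    · ext p
      have hS : p ∈ flatBox n r (-r) r → (p ∈ hypersurfaceS n ↔ definingFunction n p = 0) :=
        fun hp => mem_hypersurfaceS_iff hn (lt_one_of_mem_flatBox hn hr hp).le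
      constructor
      · rintro (⟨h1, h2, h3, h4⟩ | ⟨h1, h2, h3, h4⟩)
        · have hp : p ∈ flatBox n r (-r) r := ⟨h1, h2, by linarith, h4⟩
          exact ⟨hp, fun h => h3.ne' ((hS hp).1 h.1)⟩
        · have hp : p ∈ flatBox n r (-r) r := ⟨h1, h2, h3, by linarith⟩
          exact ⟨hp, fun h => h4.ne ((hS hp).1 h.1)⟩
      · rintro ⟨hp, h⟩
        have h0 : definingFunction n p ≠ 0 := fun h0 => h ⟨(hS hp).2 h0, hp⟩
        obtain ⟨h1, h2, h3, h4⟩ := hp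
        rcases lt_or_gt_of_ne h0 with h5 | h5
        · exact Or.inr ⟨h1, h2, h3, h5⟩
        · exact Or.inl ⟨h1, h2, h5, h4⟩
    · refine hcl 0 r ?_
      have : ∃ᶠ s in 𝓝[>] (0 : ℝ), 0 < s ∧ s < r :=
        (Filter.Eventually.frequently (Ioo_mem_nhdsGT hr0))
      exact this.filter_mono nhdsWithin_le_nhds
    · refine hcl (-r) 0 ?_
      have : ∃ᶠ s in 𝓝[<] (0 : ℝ), -r < s ∧ s < 0 :=
        (Filter.Eventually.frequently (Ioo_mem_nhdsLT (by linarith)))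
      exact this.filter_mono nhdsWithin_le_nhds

theorem flatBox_subset_ball (hn : 1 ≤ n) (r : ℝ) :
    flatBox n r (-r) r ⊆ Metric.ball 0 (3 * r) := by
  rintro p ⟨h1, h2, h3, h4⟩
  have h5 : p.2 = leafCoord n p + flatSlope n (leafCoord n p) * p.1 +
    definingFunction n p * Complex.I := congrArg Prod.snd (flatChart_coords hn p).symm
  have h0 := norm_nonneg p.1
  rw [mem_ball_zero_iff, Prod.norm_def, max_lt_iff]
  refine ⟨by linarith, ?_⟩
  rw [h5]
  calc _ ≤ ‖(leafCoord n p : ℂ)‖ + ‖(flatSlope n (leafCoord n p) : ℂ) * p.1‖ +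
      ‖(definingFunction n p : ℂ) * Complex.I‖ := norm_add₃_le
    _ < r + r + r := by
      rw [norm_mul, norm_mul, Complex.norm_I, mul_one]
      simp only [Complex.norm_real, Real.norm_eq_abs]
      rw [abs_of_nonneg (flatSlope_nonneg n _)]
      have := mul_le_of_le_one_left h0 (flatSlope_le_one n (leafCoord n p))
      have := abs_lt.2 ⟨h3, h4⟩
      linarith
    _ = 3 * r := by ring

end FlatBox

theorem exists_leviFlatPair_domain {n : ℕ} (hn : 1 ≤ n) {N : Set (ℂ × ℂ)} (hN : N ∈ 𝓝 (0 : ℂ × ℂ)) :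
    ∃ D ⊆ N, (∃ U : Set (ℂ × ℂ), IsLeviFlatPair ∞ D (hypersurfaceS n ∩ D) U) ∧
      IsRealHypersurface ω ((hypersurfaceS n ∩ D) \ {p : ℂ × ℂ | p.2 = 0}) := by
  obtain ⟨ε, hε, hball⟩ := Metric.mem_nhds_iff.1 hN
  have hn' : (1 : ℝ) ≤ n := by exact_mod_cast hn
  set r := min (ε / 3) (1 / (8 * n)) with hrdef
  have hr0 : 0 < r := by positivity
  have hr : 8 * n * r ≤ 1 := by
    have : r ≤ 1 / (8 * n) := min_le_right _ _
    rw [le_div_iff₀ (by positivity)] at this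
    linarith
  refine ⟨flatBox n r (-r) r, ?_, ⟨_, isLeviFlatPair_flatBox hn hr0 hr⟩,
    isRealHypersurface_omega_inter_flatBox_diff hn hr⟩
  refine (flatBox_subset_ball hn r).trans ((Metric.ball_subset_ball ?_).trans hball)
  have := min_le_left (ε / 3) (1 / (8 * (n : ℝ)))
  linarith

-- Uniqueness for rapidly decaying boundary values.

/-- The open half disc of radius `r` on the upper side of the real line. -/
def upperHalfDisc (r : ℝ) : Set ℂ := {w | 0 < w.im ∧ ‖w‖ < r}

theorem closure_upperHalfDisc_subset (r : ℝ) :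
    closure (upperHalfDisc r) ⊆ {w | 0 ≤ w.im ∧ ‖w‖ ≤ r} :=
  closure_minimal (fun _ hw => ⟨hw.1.le, hw.2.le⟩)
    ((isClosed_le continuous_const Complex.continuous_im).inter
      (isClosed_le continuous_norm continuous_const))

theorem isOpen_upperHalfDisc (r : ℝ) : IsOpen (upperHalfDisc r) :=
  (isOpen_lt continuous_const Complex.continuous_im).inter
    (isOpen_lt continuous_norm continuous_const)

/-- A holomorphic function on a half disc, continuous up to the boundary, whose boundary values
are `O(exp (-c / x ^ 2))` at a point of the diameter vanishes. -/
theorem eqOn_zero_of_flat_boundary_values {f : ℂ → ℂ} {r c C : ℝ} (hr : 0 < r) (hc : 0 < c)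
    (hd : DifferentiableOn ℂ f (upperHalfDisc r))
    (hcont : ContinuousOn f {w | 0 ≤ w.im ∧ ‖w‖ ≤ r})
    (h0 : f 0 = 0) (hflat : ∀ x : ℝ, x ≠ 0 → |x| ≤ r → ‖f x‖ ≤ C * Real.exp (-c / x ^ 2)) :
    ∀ w ∈ upperHalfDisc r, f w = 0 := by
  have hC : 0 ≤ C := by
    have := (norm_nonneg _).trans (hflat r hr.ne' (abs_of_pos hr).le)
    exact nonneg_of_mul_nonneg_left this (Real.exp_pos _)
  have hcomp : IsCompact {w : ℂ | 0 ≤ w.im ∧ ‖w‖ ≤ r} := by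
    refine (isCompact_closedBall (0 : ℂ) r).of_isClosed_subset
      ((isClosed_le continuous_const Complex.continuous_im).inter
      (isClosed_le continuous_norm continuous_const)) fun w hw => by simpa using hw.2
  obtain ⟨M, hM⟩ := hcomp.exists_bound_of_continuousOn hcont
  have hM0 : 0 ≤ M := (norm_nonneg _).trans (hM 0 (by simp [hr.le]))
  -- The multiplier `exp(h δ)` satisfies `Re h = (c/δ)(Im w + δ)(1/|w + iδ|² - 1/r²)`. On the
  -- diameter this is at most `c/x²`, which the decay of `f` absorbs. On the arc it is `≤ 0` since
  -- `|w + iδ| ≥ r`. The shift by `iδ` removes the pole from the closed half disc.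
  set h : ℝ → ℂ → ℂ := fun δ w =>
    ((c / δ : ℝ) : ℂ) * (Complex.I * (w + δ * Complex.I)⁻¹ +
      Complex.I * (w + δ * Complex.I) * ((r ^ 2 : ℝ) : ℂ)⁻¹) with hh
  have hre : ∀ δ w, (h δ w).re =
      c / δ * ((w.im + δ) * ((w.re ^ 2 + (w.im + δ) ^ 2)⁻¹ - (r ^ 2)⁻¹)) := by
    intro δ w
    simp only [hh, ← Complex.ofReal_inv, Complex.add_re, Complex.mul_re,
      Complex.mul_im, Complex.I_re, Complex.I_im, Complex.inv_re, Complex.inv_im, Complex.normSq_apply,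
      Complex.add_im, Complex.ofReal_re, Complex.ofReal_im]
    ring
  have hbound : ∀ δ : ℝ, 0 < δ → ∀ w ∈ upperHalfDisc r,
      ‖f w‖ ≤ max C M * Real.exp (-(h δ w).re) := by
    intro δ hδ w hw
    have hne : ∀ w : ℂ, 0 ≤ w.im → w + δ * Complex.I ≠ 0 := by
      intro w hw hw0
      have := congrArg Complex.im hw0
      simp at this
      linarith
    have hd' : DiffContOnCl ℂ (fun w => f w * Complex.exp (h δ w)) (upperHalfDisc r) := by
      constructor
      · refine hd.mul (DifferentiableOn.cexp ?_)
        intro w hw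
        have := hne w hw.1.le
        apply DifferentiableAt.differentiableWithinAt
        simp only [hh]
        fun_prop (disch := assumption)
      · refine (hcont.mono (closure_upperHalfDisc_subset r)).mul (ContinuousOn.cexp ?_)
        intro w hw
        have := hne w (closure_upperHalfDisc_subset r hw).1
        apply ContinuousAt.continuousWithinAt
        simp only [hh]
        fun_prop (disch := assumption)
    have hfr : ∀ w ∈ frontier (upperHalfDisc r), ‖f w * Complex.exp (h δ w)‖ ≤ max C M := by
      intro w hw
      rw [(isOpen_upperHalfDisc r).frontier_eq] at hw
      obtain ⟨h1, h2⟩ := closure_upperHalfDisc_subset r hw.1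
      rw [norm_mul, Complex.norm_exp]
      have hnsq : ‖w‖ ^ 2 = w.re ^ 2 + w.im ^ 2 := by
        rw [Complex.sq_norm, Complex.normSq_apply]; ring
      by_cases hw2 : ‖w‖ = r
      · have hneg : (h δ w).re ≤ 0 := by
          rw [hre]
          refine mul_nonpos_of_nonneg_of_nonpos (by positivity)
            (mul_nonpos_of_nonneg_of_nonpos (by linarith) ?_)
          rw [sub_nonpos]
          refine inv_anti₀ (by positivity) ?_
          rw [← hw2, hnsq]; nlinarith
        calc ‖f w‖ * Real.exp (h δ w).re ≤ M * 1 :=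
              mul_le_mul (hM w ⟨h1, h2⟩) (Real.exp_le_one_iff.2 hneg) (Real.exp_pos _).le hM0
          _ ≤ max C M := by simp
      · have him : w.im = 0 := by
          by_contra hne0
          exact hw.2 ⟨lt_of_le_of_ne h1 (Ne.symm hne0), lt_of_le_of_ne h2 hw2⟩
        have hwx : w = (w.re : ℂ) := by apply Complex.ext <;> simp [him]
        by_cases hx : w.re = 0
        · have hf0 : f w = 0 := by rw [hwx, hx, Complex.ofReal_zero, h0]
          simp [hf0, hC]
        have hxr : |w.re| ≤ r := (Complex.abs_re_le_norm w).trans h2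
        have e1 : (h δ w).re ≤ c / w.re ^ 2 := by
          rw [hre, him]
          have p1 : 0 < w.re ^ 2 := by positivity
          have : (w.re ^ 2 + (0 + δ) ^ 2)⁻¹ ≤ (w.re ^ 2)⁻¹ := inv_anti₀ p1 (by nlinarith)
          have p2 : 0 < (r ^ 2)⁻¹ := by positivity
          calc _ = c * ((w.re ^ 2 + (0 + δ) ^ 2)⁻¹ - (r ^ 2)⁻¹) := by field_simp; ring
            _ ≤ c * (w.re ^ 2)⁻¹ := by gcongr; linarith
            _ = _ := by rw [div_eq_mul_inv]
        have e2 := hflat w.re hx hxr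
        rw [← hwx] at e2
        calc ‖f w‖ * Real.exp (h δ w).re
            ≤ (C * Real.exp (-c / w.re ^ 2)) * Real.exp (c / w.re ^ 2) := by gcongr
          _ = C := by rw [mul_assoc, ← Real.exp_add, neg_div, neg_add_cancel, Real.exp_zero, mul_one]
          _ ≤ _ := le_max_left _ _
    have hbdd : Bornology.IsBounded (upperHalfDisc r) :=
      (Metric.isBounded_ball (x := (0 : ℂ)) (r := r)).subset fun w hw => by simpa using hw.2
    have := Complex.norm_le_of_forall_mem_frontier_norm_le hbdd hd' hfr (subset_closure hw)
    rw [norm_mul, Complex.norm_exp] at this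
    rw [Real.exp_neg, ← div_eq_mul_inv, le_div_iff₀ (Real.exp_pos _)]
    exact this
  intro w hw
  -- At a fixed interior point `Re h` grows like a positive multiple of `1/δ`, so the bound from the
  -- maximum principle tends to zero.
  have hlim : Filter.Tendsto (fun δ : ℝ => max C M * Real.exp (-(h δ w).re)) (𝓝[>] 0) (𝓝 0) := by
    suffices htop : Filter.Tendsto (fun δ : ℝ => (h δ w).re) (𝓝[>] 0) Filter.atTop by
      simpa using (Real.tendsto_exp_neg_atTop_nhds_zero.comp htop).const_mul (max C M)
    have hlim' : Filter.Tendsto (fun δ : ℝ => (w.im + δ) *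
        ((w.re ^ 2 + (w.im + δ) ^ 2)⁻¹ - (r ^ 2)⁻¹)) (𝓝[>] 0)
        (𝓝 (w.im * ((w.re ^ 2 + w.im ^ 2)⁻¹ - (r ^ 2)⁻¹))) := by
      have hpos : w.re ^ 2 + (w.im + 0) ^ 2 ≠ 0 := by have := hw.1; positivity
      have : ContinuousAt (fun δ : ℝ => (w.im + δ) *
        ((w.re ^ 2 + (w.im + δ) ^ 2)⁻¹ - (r ^ 2)⁻¹)) 0 := by
        fun_prop (disch := assumption)
      have h2 := this.tendsto.mono_left (nhdsWithin_le_nhds (s := Set.Ioi 0))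
      simpa using h2
    have hpos : 0 < w.im * ((w.re ^ 2 + w.im ^ 2)⁻¹ - (r ^ 2)⁻¹) := by
      have hnsq : ‖w‖ ^ 2 = w.re ^ 2 + w.im ^ 2 := by
        rw [Complex.sq_norm, Complex.normSq_apply]; ring
      have h1 := hw.1
      refine mul_pos h1 (sub_pos.2 (inv_strictAnti₀ (by positivity) ?_))
      rw [← hnsq]
      exact pow_lt_pow_left₀ hw.2 (norm_nonneg _) two_ne_zero
    have := (Filter.Tendsto.const_mul_atTop hc tendsto_inv_nhdsGT_zero).atTop_mul_pos hpos hlim'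
    refine this.congr fun δ => ?_
    rw [hre, div_eq_mul_inv]
  have : ‖f w‖ ≤ 0 := by
    refine ge_of_tendsto hlim ?_
    filter_upwards [self_mem_nhdsWithin] with δ hδ using hbound δ hδ w hw
  exact norm_le_zero_iff.1 this

theorem eq_zero_on_diameter_of_flat_boundary_values {f : ℂ → ℂ} {r c C : ℝ} (hr : 0 < r)
    (hc : 0 < c) (hd : DifferentiableOn ℂ f (upperHalfDisc r))
    (hcont : ContinuousOn f {w | 0 ≤ w.im ∧ ‖w‖ ≤ r}) (h0 : f 0 = 0)
    (hflat : ∀ x : ℝ, x ≠ 0 → |x| ≤ r → ‖f x‖ ≤ C * Real.exp (-c / x ^ 2))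
    {x : ℝ} (hx : |x| < r) : f x = 0 := by
  have hz := eqOn_zero_of_flat_boundary_values hr hc hd hcont h0 hflat
  have hlim : Filter.Tendsto (fun ε : ℝ => (x : ℂ) + ε * Complex.I) (𝓝[>] (0 : ℝ))
      (𝓝[{w : ℂ | 0 ≤ w.im ∧ ‖w‖ ≤ r}] (x : ℂ)) ∧
      ∀ᶠ ε : ℝ in 𝓝[>] (0 : ℝ), (x : ℂ) + ε * Complex.I ∈ upperHalfDisc r := by
    have hcts : Filter.Tendsto (fun ε : ℝ => (x : ℂ) + ε * Complex.I) (𝓝[>] (0 : ℝ)) (𝓝 (x : ℂ)) := by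
      have : Continuous fun ε : ℝ => (x : ℂ) + ε * Complex.I := by fun_prop
      simpa using (this.tendsto 0).mono_left (nhdsWithin_le_nhds (s := Set.Ioi 0))
    have hev : ∀ᶠ ε : ℝ in 𝓝[>] (0 : ℝ), (x : ℂ) + ε * Complex.I ∈ upperHalfDisc r := by
      have h1 := hcts.norm.eventually_lt_const (u := r) (by simpa using hx)
      filter_upwards [h1, self_mem_nhdsWithin] with ε h2 h3
      exact ⟨by simpa using h3, h2⟩
    exact ⟨tendsto_nhdsWithin_iff.2 ⟨hcts, hev.mono fun ε h => ⟨h.1.le, h.2.le⟩⟩, hev⟩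
  have hfx : Filter.Tendsto (fun ε : ℝ => f ((x : ℂ) + ε * Complex.I)) (𝓝[>] (0 : ℝ)) (𝓝 (f x)) :=
    (hcont x ⟨by simp, by simpa using hx.le⟩).tendsto.comp hlim.1
  refine tendsto_nhds_unique hfx (tendsto_const_nhds.congr' ?_)
  filter_upwards [hlim.2] with ε hε using (hz _ hε).symm

-- Tangency to leaves, and the sides of `S_n`.

/-- The image leaf may a priori vary with `z`, and `τ` is not assumed continuous. Put `K = G - h(τ
0) F`. Its increments are `τ z - τ 0`, which is real, plus an error of at most half that size, so
they stay in the cone `|Im| ≤ |Re|`. A nonzero complex derivative of `K` would produce increments in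
the direction `i`, outside the cone. -/
theorem hasDerivAt_eq_of_mem_leaves {h : ℝ → ℝ} {M : ℝ}
    (hM : ∀ s t, |h s - h t| ≤ M * |s - t|) {F G : ℂ → ℂ} {F' G' : ℂ} {τ : ℂ → ℝ}
    (hF : HasDerivAt F F' 0) (hG : HasDerivAt G G' 0)
    (hFM : ∀ᶠ z in 𝓝 (0 : ℂ), M * ‖F z‖ ≤ 1 / 2)
    (hτ : ∀ᶠ z in 𝓝 (0 : ℂ), G z = τ z + h (τ z) * F z) :
    G' = h (τ 0) * F' := by
  by_contra hne
  set k := G' - h (τ 0) * F' with hk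
  have hk0 : k ≠ 0 := sub_ne_zero.2 hne
  set K : ℂ → ℂ := fun z => G z - h (τ 0) * F z with hK
  have hKd : HasDerivAt K k 0 := hG.sub (hF.const_mul _)
  have hcone : ∀ᶠ z in 𝓝 (0 : ℂ), |(K z - K 0).im| ≤ |(K z - K 0).re| := by
    have hτ0 := hτ.self_of_nhds
    filter_upwards [hFM, hτ] with z h1 h2
    set q : ℂ := ((h (τ z) - h (τ 0) : ℝ) : ℂ) * F z with hq
    have hqn : ‖q‖ ≤ |τ z - τ 0| / 2 := by
      rw [hq, norm_mul, Complex.norm_real, Real.norm_eq_abs]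
      have := mul_le_mul_of_nonneg_right (hM (τ z) (τ 0)) (norm_nonneg (F z))
      nlinarith [abs_nonneg (τ z - τ 0)]
    have hKq : K z - K 0 = ((τ z - τ 0 : ℝ) : ℂ) + q := by
      simp only [hK, hq]
      rw [h2, hτ0]
      push_cast
      ring
    rw [hKq]
    have h3 := (Complex.abs_im_le_norm q).trans hqn
    have h4 := (Complex.abs_re_le_norm q).trans hqn
    simp only [Complex.add_im, Complex.ofReal_im, zero_add, Complex.add_re, Complex.ofReal_re]
    have h5 := abs_sub_abs_le_abs_sub (τ z - τ 0) (-q.re)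
    rw [abs_neg, sub_neg_eq_add] at h5
    linarith
  set φ : ℝ → ℂ := fun s => K (s * (Complex.I / k)) with hφ
  have hφd : HasDerivAt φ Complex.I 0 := by
    have h1 : HasDerivAt (fun s : ℝ => (s : ℂ) * (Complex.I / k)) (1 * (Complex.I / k)) 0 :=
      (Complex.ofRealCLM.hasDerivAt (x := (0 : ℝ))).mul_const _
    have h2 := HasDerivAt.comp_of_eq (h₂ := K) (0 : ℝ) hKd h1 (by simp)
    rwa [one_mul, mul_div_cancel₀ _ hk0] at h2
  have hre : HasDerivAt (fun s => (φ s).re) 0 0 := by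
    have h1 : HasDerivAt (fun s => (φ s).re) (Complex.reCLM Complex.I) 0 :=
      Complex.reCLM.hasFDerivAt.comp_hasDerivAt (0 : ℝ) hφd
    simpa using h1
  have him : HasDerivAt (fun s => (φ s).im) 1 0 := by
    have h1 : HasDerivAt (fun s => (φ s).im) (Complex.imCLM Complex.I) 0 :=
      Complex.imCLM.hasFDerivAt.comp_hasDerivAt (0 : ℝ) hφd
    simpa using h1
  have him' : HasDerivAt (fun s => (φ s).im) 0 0 := by
    rw [hasDerivAt_iff_isLittleO] at hre ⊢
    refine Asymptotics.IsBigO.trans_isLittleO (Asymptotics.IsBigO.of_bound 1 ?_) hre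
    have hlim : Filter.Tendsto (fun s : ℝ => (s : ℂ) * (Complex.I / k)) (𝓝 0) (𝓝 0) := by
      have : Continuous fun s : ℝ => (s : ℂ) * (Complex.I / k) := by fun_prop
      simpa using this.tendsto 0
    filter_upwards [hlim.eventually hcone] with s hs
    simpa [hφ] using hs
  exact one_ne_zero (him.unique him')

/-- `U` meets any small flat box around `0` off `S_n`. The half box `s > 0` or `s < 0` that it meets
is connected and avoids `S_n`, hence lies in `U`. On `z = 0` the coordinates are `t = Re w` and `s =
Im w`; the sign `σ` records which half occurs. -/
theorem exists_halfDisc_subset_side {n : ℕ} (hn : 1 ≤ n) {D U : Set (ℂ × ℂ)}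
    (h : IsLeviFlatPair ∞ D (hypersurfaceS n ∩ D) U) :
    ∃ r : ℝ, 0 < r ∧ ∃ σ : ℝ, (σ = 1 ∨ σ = -1) ∧
      ∀ w : ℂ, ‖w‖ < r → 0 < σ * w.im → ((0, w) : ℂ × ℂ) ∈ U := by
  obtain ⟨U', hU, hU', -, -, hdisj, hunion, hcl, -⟩ := h.divides
  obtain ⟨ε, hε, hball⟩ := Metric.isOpen_iff.1 h.isOpen_domain 0 h.zero_mem.2
  have hn' : (1 : ℝ) ≤ n := by exact_mod_cast hn
  set r := min (ε / 3) (1 / (8 * n)) with hrdef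
  have hr0 : 0 < r := by positivity
  have hr : 8 * n * r ≤ 1 := by
    have : r ≤ 1 / (8 * n) := min_le_right _ _
    rw [le_div_iff₀ (by positivity)] at this
    linarith
  have hboxD : flatBox n r (-r) r ⊆ D := by
    refine (flatBox_subset_ball hn r).trans ((Metric.ball_subset_ball ?_).trans hball)
    have := min_le_left (ε / 3) (1 / (8 * (n : ℝ)))
    linarith
  have hUsub : U ∪ U' = D \ hypersurfaceS n := by
    rw [hunion]; ext p; simp +contextual
  have h0box : (0 : ℂ × ℂ) ∈ flatBox n r (-r) r := (isLeviFlatPair_flatBox hn hr0 hr).zero_mem.2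
  obtain ⟨p, hpbox, hpU⟩ := mem_closure_iff.1 (hcl h.zero_mem) _ (isOpen_flatBox hn hr) h0box
  have hside : ∀ a b, a < b → -r ≤ a → b ≤ r → (∀ s, a < s → s < b → s ≠ 0) →
      a < definingFunction n p → definingFunction n p < b → flatBox n r a b ⊆ U := by
    intro a b hab ha hb hne hpa hpb
    refine (isConnected_flatBox hn hr0 hr hab).isPreconnected.subset_left_of_subset_union hU hU'
      hdisj ?_ ⟨p, ⟨hpbox.1, hpbox.2.1, hpa, hpb⟩, hpU⟩
    rw [hUsub]
    rintro q hq
    refine ⟨hboxD ⟨hq.1, hq.2.1, ha.trans_lt hq.2.2.1, hq.2.2.2.trans_le hb⟩, fun hqS => ?_⟩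
    exact hne _ hq.2.2.1 hq.2.2.2
      ((mem_hypersurfaceS_iff hn (lt_one_of_mem_flatBox hn hr hq).le).1 hqS)
  have hp0 : definingFunction n p ≠ 0 := fun h0 => by
    have hp : p ∈ D \ hypersurfaceS n := hUsub ▸ Or.inl hpU
    exact hp.2 ((mem_hypersurfaceS_iff hn (lt_one_of_mem_flatBox hn hr hpbox).le).2 h0)
  have hcoord : ∀ w : ℂ, leafCoord n (0, w) = w.re ∧ definingFunction n (0, w) = w.im := by
    intro w
    exact ⟨leafParam_unique hn (by simp) (by simp), by simp [definingFunction]⟩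
  refine ⟨r, hr0, ?_⟩
  rcases lt_or_gt_of_ne hp0 with hneg | hpos
  · refine ⟨-1, Or.inr rfl, fun w hw hs => ?_⟩
    refine hside (-r) 0 (by linarith) le_rfl hr0.le (fun s _ h => h.ne) hpbox.2.2.1 hneg ?_
    refine ⟨by simpa using hr0, ?_, ?_⟩
    · rw [(hcoord w).1]; exact (Complex.abs_re_le_norm w).trans_lt hw
    · rw [(hcoord w).2]
      exact ⟨(abs_lt.1 ((Complex.abs_im_le_norm w).trans_lt hw)).1, by linarith⟩
  · refine ⟨1, Or.inl rfl, fun w hw hs => ?_⟩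
    refine hside 0 r hr0 (by linarith) le_rfl (fun s h _ => h.ne') hpos hpbox.2.2.2 ?_
    refine ⟨by simpa using hr0, ?_, ?_⟩
    · rw [(hcoord w).1]; exact (Complex.abs_re_le_norm w).trans_lt hw
    · rw [(hcoord w).2]
      exact ⟨by linarith, (abs_lt.1 ((Complex.abs_im_le_norm w).trans_lt hw)).2⟩

-- Derivatives of holomorphic maps up to the boundary.

section BoundaryDerivative

variable {E F : Type*} [NormedAddCommGroup E] [NormedSpace ℂ E] [NormedAddCommGroup F]
  [NormedSpace ℂ F]

/-- The second derivative `B` is complex linear in the slot of the vector, because each first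
derivative is; symmetry moves this linearity to the slot of the base point. -/
theorem ContDiffOn.differentiableAt_fderiv_apply_complex {W : Set E} {f : E → F} (hW : IsOpen W)
    (hf : ContDiffOn ℝ 2 f W) (hd : DifferentiableOn ℂ f W) {x : E} (hx : x ∈ W) (v : E) :
    DifferentiableAt ℂ (fun y => fderiv ℝ f y v) x := by
  have hfx : ContDiffAt ℝ 2 f x := hf.contDiffAt (hW.mem_nhds hx)
  have hlin : ∀ y ∈ W, ∀ (c : ℂ) (u : E), fderiv ℝ f y (c • u) = c • fderiv ℝ f y u := by
    intro y hy c u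
    rw [(hd.differentiableAt (hW.mem_nhds hy)).fderiv_restrictScalars ℝ]
    simp
  have hB : HasFDerivAt (fderiv ℝ f) (fderiv ℝ (fderiv ℝ f) x) x :=
    ((hfx.fderiv_right (m := 1) (by norm_num)).differentiableAt one_ne_zero).hasFDerivAt
  set B := fderiv ℝ (fderiv ℝ f) x
  have happ : ∀ u : E, HasFDerivAt (fun y => fderiv ℝ f y u) (B.flip u) x := fun u => by
    simpa using hB.clm_apply (hasFDerivAt_const u x)
  have hsymm : ∀ u w, B u w = B w u := fun u w => hfx.isSymmSndFDerivAt (by simp) u w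
  have hBlin : ∀ (c : ℂ) (u w : E), B w (c • u) = c • B w u := by
    intro c u w
    have h1 : HasFDerivAt (fun y => c • fderiv ℝ f y u) (c • B.flip u) x := (happ u).const_smul c
    have h2 : HasFDerivAt (fun y => c • fderiv ℝ f y u) (B.flip (c • u)) x :=
      (happ (c • u)).congr_of_eventuallyEq (by
        filter_upwards [hW.mem_nhds hx] with y hy using (hlin y hy c u).symm)
    exact congrArg (fun T : E →L[ℝ] F => T w) (h2.unique h1)
  let B' : E →L[ℂ] F :=
    { toFun := fun w => B w v
      map_add' := fun a b => by simp
      map_smul' := fun c w => by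
        rw [hsymm, hBlin, hsymm]; rfl
      cont := (B.flip v).continuous }
  exact (hasFDerivAt_of_restrictScalars ℝ (happ v) (f' := B') rfl).differentiableAt

/-- A holomorphic map on `U`, smooth up to the boundary piece `S`, has a continuous complex linear
derivative up to `S`. -/
theorem exists_boundary_derivative {N U S : Set E} {Φ : E → F} {x₀ : E}
    (hN : IsOpen N) (hU : IsOpen U) (h0N : x₀ ∈ N) (h0S : x₀ ∈ S) (hcl : S ⊆ closure U)
    (hol : DifferentiableOn ℂ Φ (N ∩ U)) (hs : ContDiffOn ℝ 1 Φ (N ∩ (U ∪ S))) :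
    ∃ r : ℝ, 0 < r ∧ Metric.ball x₀ r ⊆ N ∧ ∃ A : E → E →L[ℝ] F,
      ContinuousOn A (Metric.ball x₀ r ∩ (U ∪ S)) ∧
      (∀ x ∈ Metric.ball x₀ r ∩ (U ∪ S), HasFDerivWithinAt Φ (A x) (N ∩ (U ∪ S)) x) ∧
      (∀ x ∈ Metric.ball x₀ r ∩ U, HasFDerivAt Φ (A x) x) ∧
      ∀ x ∈ Metric.ball x₀ r ∩ (U ∪ S), ∀ (c : ℂ) (v : E), A x (c • v) = c • A x v := by
  have h0X : x₀ ∈ N ∩ (U ∪ S) := ⟨h0N, Or.inr h0S⟩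
  have hins : insert x₀ (N ∩ (U ∪ S)) = N ∩ (U ∪ S) := Set.insert_eq_of_mem h0X
  have h1 := hs x₀ h0X
  rw [← zero_add (1 : WithTop ℕ∞), contDiffWithinAt_succ_iff_hasFDerivWithinAt' (by simp), hins] at h1
  obtain ⟨u, hu, -, -, A, hAd, hAc⟩ := h1
  obtain ⟨u', hu', -, hAc'⟩ := hAc.contDiffOn le_rfl (by simp)
  rw [hins] at hu'
  obtain ⟨r, hr, hball⟩ := Metric.mem_nhdsWithin_iff.1 (Filter.inter_mem hu hu')
  obtain ⟨r', hr', hballN⟩ := Metric.isOpen_iff.1 hN x₀ h0N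
  set ρ := min r r' with hρ
  have hρN : Metric.ball x₀ ρ ⊆ N := (Metric.ball_subset_ball (min_le_right _ _)).trans hballN
  have hsub : Metric.ball x₀ ρ ∩ (U ∪ S) ⊆ u ∩ u' := fun x hx =>
    hball ⟨Metric.ball_subset_ball (min_le_left _ _) hx.1, hρN hx.1, hx.2⟩
  have hcont : ContinuousOn A (Metric.ball x₀ ρ ∩ (U ∪ S)) :=
    hAc'.continuousOn.mono fun x hx => (hsub hx).2
  have hint : ∀ x ∈ Metric.ball x₀ ρ ∩ U, HasFDerivAt Φ (A x) x := fun x hx =>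
    (hAd x (hsub ⟨hx.1, Or.inl hx.2⟩).1).hasFDerivAt (Filter.mem_of_superset
      ((hN.inter hU).mem_nhds ⟨hρN hx.1, hx.2⟩) fun y hy => ⟨hy.1, Or.inl hy.2⟩)
  refine ⟨ρ, lt_min hr hr', hρN, A, hcont, fun x hx => hAd x (hsub hx).1, hint, ?_⟩
  intro x hx c v
  -- Complex linearity holds in `U` by holomorphy and passes to `S` by continuity of `A`.
  have heq : Set.EqOn (fun x => A x (c • v)) (fun x => c • A x v) (Metric.ball x₀ ρ ∩ U) := by
    intro y hy
    have hd := hol.differentiableAt ((hN.inter hU).mem_nhds ⟨hρN hy.1, hy.2⟩)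
    have := (hint y hy).unique (hd.hasFDerivAt.restrictScalars ℝ)
    simp [this]
  refine heq.of_subset_closure (hcont.clm_apply continuousOn_const)
    ((hcont.clm_apply continuousOn_const).const_smul c)
    (fun y hy => ⟨hy.1, Or.inl hy.2⟩) ?_ hx
  rintro y ⟨hy1, hy2⟩
  have hyc : y ∈ closure U := hy2.elim (fun h => subset_closure h) (fun h => hcl h)
  exact Metric.isOpen_ball.inter_closure ⟨hy1, hyc⟩

end BoundaryDerivative

-- Leaf slopes under an equivalence, and recovery of the exponent.

/-- The leaf stays in `X`, so the one-sided derivative of `Φ` gives a full derivative of `Φ` along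
the leaf, and complex linearity of `A` makes it a complex one. The cone argument then applies to the
two components. -/
theorem leaf_derivative_eq {m : ℕ} (hm : 1 ≤ m) {X : Set (ℂ × ℂ)} {Φ : ℂ × ℂ → ℂ × ℂ}
    {A : ℂ × ℂ →L[ℝ] ℂ × ℂ} {t g : ℝ}
    (hX : ∀ᶠ z in 𝓝 (0 : ℂ), ((z, t + g * z) : ℂ × ℂ) ∈ X)
    (hS : ∀ᶠ z in 𝓝 (0 : ℂ), Φ (z, t + g * z) ∈ hypersurfaceS m)
    (hA : HasFDerivWithinAt Φ A X (0, (t : ℂ)))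
    (hlin : ∀ (c : ℂ) (v : ℂ × ℂ), A (c • v) = c • A v)
    (hsmall : 4 * m * ‖(Φ (0, (t : ℂ))).1‖ < 1 / 2) :
    ∃ τ : ℝ, (Φ (0, (t : ℂ))).2 = τ + flatSlope m τ * (Φ (0, (t : ℂ))).1 ∧
      (A (1, (g : ℂ))).2 = flatSlope m τ * (A (1, (g : ℂ))).1 := by
  set γ : ℂ → ℂ × ℂ := fun z => (z, t + g * z) with hγ
  have hγ0 : γ 0 = (0, (t : ℂ)) := by simp [hγ]
  have hγd : HasDerivAt γ (1, (g : ℂ)) 0 := by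
    have := (hasDerivAt_id (0 : ℂ)).prodMk (((hasDerivAt_id (0 : ℂ)).const_mul (g : ℂ)).const_add (t : ℂ))
    simpa using this
  have hΦγ : HasDerivAt (Φ ∘ γ) (A (1, (g : ℂ))) 0 := by
    have hγr : HasFDerivWithinAt γ
        ((ContinuousLinearMap.toSpanSingleton ℂ ((1, (g : ℂ)) : ℂ × ℂ)).restrictScalars ℝ)
        (γ ⁻¹' X) 0 := (hγd.hasFDerivAt.restrictScalars ℝ).hasFDerivWithinAt
    have h1 := HasFDerivWithinAt.comp (g := Φ) (0 : ℂ) (hγ0.symm ▸ hA) hγr (Set.mapsTo_preimage γ X)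
    have h2 := h1.hasFDerivAt hX
    refine hasFDerivAt_of_restrictScalars ℝ h2 ?_
    ext1 z
    simp [← hlin]
  have hF : HasDerivAt (fun z => (Φ (γ z)).1) (A (1, (g : ℂ))).1 0 :=
    (ContinuousLinearMap.fst ℂ ℂ ℂ).hasFDerivAt.comp_hasDerivAt (0 : ℂ) hΦγ
  have hG : HasDerivAt (fun z => (Φ (γ z)).2) (A (1, (g : ℂ))).2 0 :=
    (ContinuousLinearMap.snd ℂ ℂ ℂ).hasFDerivAt.comp_hasDerivAt (0 : ℂ) hΦγ
  have hex : ∀ z, ∃ τ : ℝ, Φ (γ z) ∈ hypersurfaceS m →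
      (Φ (γ z)).2 = τ + flatSlope m τ * (Φ (γ z)).1 := fun z => by
    by_cases h : Φ (γ z) ∈ hypersurfaceS m
    · obtain ⟨τ, hτ⟩ := h
      exact ⟨τ, fun _ => hτ⟩
    · exact ⟨0, fun h' => absurd h' h⟩
  choose τ hτ using hex
  refine ⟨τ 0, ?_, ?_⟩
  · have := hτ 0 hS.self_of_nhds
    rwa [hγ0] at this
  · refine hasDerivAt_eq_of_mem_leaves (flatSlope_lipschitz hm) hF hG ?_ (hS.mono hτ)
    have hc : ContinuousAt (fun z => 4 * (m : ℝ) * ‖(Φ (γ z)).1‖) 0 :=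
      continuousAt_const.mul hF.continuousAt.norm
    refine (hc.eventually_lt_const (u := 1 / 2) ?_).mono fun z h => h.le
    dsimp only
    rwa [hγ0]

theorem abs_le_norm_of_mem_leaf {m : ℕ} (hm : 1 ≤ m) {τ : ℝ} {p : ℂ × ℂ}
    (hp : p.2 = τ + flatSlope m τ * p.1) (hsmall : 4 * m * ‖p.1‖ < 1 / 2) :
    |τ| ≤ 2 * ‖p.2‖ ∧ ‖p.2‖ ≤ 2 * |τ| := by
  have h1 : ‖(flatSlope m τ : ℂ) * p.1‖ ≤ |τ| / 2 := by
    rw [norm_mul, Complex.norm_real, Real.norm_eq_abs, abs_of_nonneg (flatSlope_nonneg m τ)]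
    have := mul_le_mul_of_nonneg_right (flatSlope_le_mul_abs hm τ) (norm_nonneg p.1)
    nlinarith [abs_nonneg τ]
  have h2 : ‖(τ : ℂ)‖ = |τ| := by simp
  constructor
  · have : (τ : ℂ) = p.2 - flatSlope m τ * p.1 := by rw [hp]; ring
    have h3 := norm_sub_le p.2 (flatSlope m τ * p.1)
    rw [← this, h2] at h3
    linarith
  · have h3 := norm_add_le (τ : ℂ) (flatSlope m τ * p.1)
    rw [← hp, h2] at h3
    linarith [abs_nonneg τ]

/-- After logarithms, `t^(-2n)` and `s^(-2m)` with `s = |τ|` differ by a bounded amount while `s` is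
comparable to `t`. Multiplying by `t` to the larger of the two powers and letting `t → 0` makes a
positive constant `O(t²)` if `n ≠ m`. -/
theorem exponent_eq_of_flatSlope_comparable {n m : ℕ} {α β C : ℝ} (hα : 0 < α)
    (hC : 0 < C) (hcomp : ∀ᶠ t in 𝓝[>] (0 : ℝ), ∃ τ : ℝ, α * |t| ≤ |τ| ∧ |τ| ≤ β * |t| ∧
      flatSlope n t ≤ C * flatSlope m τ ∧ flatSlope m τ ≤ C * flatSlope n t) : n = m := by
  have hlog : ∀ᶠ t in 𝓝[>] (0 : ℝ), ∃ s : ℝ, α * t ≤ s ∧ s ≤ β * t ∧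
      1 / s ^ (2 * m) ≤ Real.log C + 1 / t ^ (2 * n) ∧
      1 / t ^ (2 * n) ≤ Real.log C + 1 / s ^ (2 * m) := by
    filter_upwards [hcomp, self_mem_nhdsWithin] with t ⟨τ, h1, h2, h3, h4⟩ ht
    have ht0 : (0 : ℝ) < t := ht
    rw [abs_of_pos ht0] at h1 h2
    have hτ : τ ≠ 0 := abs_pos.1 (lt_of_lt_of_le (by positivity) h1)
    refine ⟨|τ|, h1, h2, ?_⟩
    rw [(even_two_mul m).pow_abs]
    rw [flatSlope_of_ne hτ, flatSlope_of_ne ht0.ne'] at h3 h4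
    nth_rw 1 [← Real.exp_log hC] at h3 h4
    rw [← Real.exp_add, Real.exp_le_exp, neg_div, neg_div] at h3 h4
    constructor <;> linarith
  have hsq : ∀ K : ℝ, Filter.Tendsto (fun t : ℝ => K * t ^ 2) (𝓝[>] 0) (𝓝 0) := fun K => by
    have : Continuous fun t : ℝ => K * t ^ 2 := by fun_prop
    simpa using (this.tendsto 0).mono_left (nhdsWithin_le_nhds (s := Set.Ioi 0))
  have hpow : ∀ {t : ℝ} {k : ℕ}, 0 < t → t < 1 → 1 ≤ k → t ^ (2 * k) ≤ t ^ 2 := fun h0 h1 hk =>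
    pow_le_pow_of_le_one h0.le h1.le (by omega)
  have h01 := Ioo_mem_nhdsGT (one_pos (α := ℝ))
  rcases lt_trichotomy n m with h | h | h
  · exfalso
    have hβ : 0 < β := by
      obtain ⟨t, ⟨s, h1, h2, -⟩, ht, -⟩ := (hlog.and h01).exists
      have := h1.trans h2
      exact hα.trans_le (le_of_mul_le_mul_right this ht)
    have hle : (1 / β ^ (2 * m)) ≤ 0 := by
      refine ge_of_tendsto (hsq (|Real.log C| + 1)) ?_
      filter_upwards [hlog, h01] with t ⟨s, h1, h2, h3, _⟩ ⟨ht0, ht1⟩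
      have hs : 0 < s := lt_of_lt_of_le (by positivity) h1
      have e1 : 1 / (β * t) ^ (2 * m) ≤ 1 / s ^ (2 * m) := by gcongr
      have e2 : 1 / β ^ (2 * m) = 1 / (β * t) ^ (2 * m) * t ^ (2 * m) := by
        rw [mul_pow]; field_simp
      have e3 : 1 / t ^ (2 * n) * t ^ (2 * m) = t ^ (2 * (m - n)) := by
        rw [show 2 * m = 2 * n + 2 * (m - n) by omega, pow_add]; field_simp
      calc 1 / β ^ (2 * m) ≤ (|Real.log C| + 1 / t ^ (2 * n)) * t ^ (2 * m) := by
            rw [e2]; gcongr; linarith [le_abs_self (Real.log C)]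
        _ = |Real.log C| * t ^ (2 * m) + t ^ (2 * (m - n)) := by rw [add_mul, e3]
        _ ≤ |Real.log C| * t ^ 2 + t ^ 2 := by
            gcongr ?_ * ?_ + ?_
            · exact hpow ht0 ht1 (by omega)
            · exact hpow ht0 ht1 (by omega)
        _ = _ := by ring
    have : 0 < 1 / β ^ (2 * m) := by positivity
    linarith
  · exact h
  · exfalso
    have hle : (1 : ℝ) ≤ 0 := by
      refine ge_of_tendsto (hsq (|Real.log C| + 1 / α ^ (2 * m))) ?_
      filter_upwards [hlog, h01] with t ⟨s, h1, h2, _, h3⟩ ⟨ht0, ht1⟩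
      have hs : 0 < s := lt_of_lt_of_le (by positivity) h1
      have e1 : 1 / s ^ (2 * m) ≤ 1 / (α * t) ^ (2 * m) := by gcongr
      have e3 : 1 / (α * t) ^ (2 * m) * t ^ (2 * n) = 1 / α ^ (2 * m) * t ^ (2 * (n - m)) := by
        rw [show 2 * n = 2 * m + 2 * (n - m) by omega, pow_add, mul_pow]
        field_simp
      calc (1 : ℝ) = 1 / t ^ (2 * n) * t ^ (2 * n) := by field_simp
        _ ≤ (|Real.log C| + 1 / (α * t) ^ (2 * m)) * t ^ (2 * n) := by
            gcongr; linarith [le_abs_self (Real.log C)]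
        _ = |Real.log C| * t ^ (2 * n) + 1 / α ^ (2 * m) * t ^ (2 * (n - m)) := by rw [add_mul, e3]
        _ ≤ |Real.log C| * t ^ 2 + 1 / α ^ (2 * m) * t ^ 2 := by
            gcongr ?_ * ?_ + ?_ * ?_
            · exact hpow ht0 ht1 (by omega)
            · exact hpow ht0 ht1 (by omega)
        _ = _ := by ring
    linarith

theorem Filter.Tendsto.continuousLinearMap_apply {ι E F : Type*} [NormedAddCommGroup E]
    [NormedSpace ℝ E] [NormedAddCommGroup F] [NormedSpace ℝ F] {l : Filter ι}
    {T : ι → E →L[ℝ] F} {T₀ : E →L[ℝ] F} {v : ι → E} {v₀ : E}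
    (hT : Filter.Tendsto T l (𝓝 T₀)) (hv : Filter.Tendsto v l (𝓝 v₀)) :
    Filter.Tendsto (fun i => T i (v i)) l (𝓝 (T₀ v₀)) :=
  (isBoundedBilinearMap_apply.continuous.tendsto (T₀, v₀)).comp (hT.prodMk_nhds hv)

/-- If the holomorphic maps `Φ : N₁ ∩ U₁ → N₂ ∩ U₂` and `Ψ` are mutually inverse and of class `C¹`
up to the boundary, then the boundary derivative of `Φ` is injective. -/
theorem boundary_derivative_injective {E : Type*} [NormedAddCommGroup E] [NormedSpace ℂ E]
    {N₁ N₂ U₁ U₂ S₁ S₂ : Set E} {Φ Ψ : E → E}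
    (hN₁ : IsOpen N₁) (hN₂ : IsOpen N₂) (hU₁ : IsOpen U₁) (hU₂ : IsOpen U₂)
    (h0N₁ : (0 : E) ∈ N₁) (h0N₂ : (0 : E) ∈ N₂) (h0S₁ : (0 : E) ∈ S₁) (h0S₂ : (0 : E) ∈ S₂)
    (hcl₁ : S₁ ⊆ closure U₁) (hcl₂ : S₂ ⊆ closure U₂)
    (hmaps : Set.MapsTo Φ (N₁ ∩ U₁) (N₂ ∩ U₂)) (hinv : Set.LeftInvOn Ψ Φ (N₁ ∩ U₁))
    (holΨ : DifferentiableOn ℂ Ψ (N₂ ∩ U₂))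
    (hΨ : ContDiffOn ℝ 1 Ψ (N₂ ∩ (U₂ ∪ S₂)))
    (hΦc : ContinuousOn Φ (N₁ ∩ (U₁ ∪ S₁))) (hΦ0 : Φ 0 = 0) {r : ℝ} (hr : 0 < r)
    (hball : Metric.ball 0 r ⊆ N₁) {A : E → E →L[ℝ] E}
    (hA : ContinuousOn A (Metric.ball 0 r ∩ (U₁ ∪ S₁)))
    (hAd : ∀ x ∈ Metric.ball 0 r ∩ U₁, HasFDerivAt Φ (A x) x) :
    Function.Injective (A 0) := by
  obtain ⟨r₂, hr₂, -, B, hBc, -, hBd, -⟩ :=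
    exists_boundary_derivative hN₂ hU₂ h0N₂ h0S₂ hcl₂ holΨ hΨ
  have hne : (𝓝[U₁] (0 : E)).NeBot := mem_closure_iff_nhdsWithin_neBot.1 (hcl₁ h0S₁)
  have hΦlim : Filter.Tendsto Φ (𝓝[U₁] 0) (𝓝 0) := by
    have h1 := (hΦc 0 ⟨h0N₁, Or.inr h0S₁⟩).tendsto
    rw [hΦ0] at h1
    refine h1.mono_left (nhdsWithin_le_iff.2 ?_)
    filter_upwards [self_mem_nhdsWithin, mem_nhdsWithin_of_mem_nhds (hN₁.mem_nhds h0N₁)]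
      with x h2 h3 using ⟨h3, Or.inl h2⟩
  have hev : ∀ᶠ x in 𝓝[U₁] (0 : E), x ∈ Metric.ball 0 r ∩ U₁ :=
    Filter.inter_mem (mem_nhdsWithin_of_mem_nhds (Metric.ball_mem_nhds 0 hr)) self_mem_nhdsWithin
  have hΦev : ∀ᶠ x in 𝓝[U₁] (0 : E), Φ x ∈ Metric.ball 0 r₂ ∩ U₂ := by
    filter_upwards [hev, hΦlim.eventually (Metric.ball_mem_nhds 0 hr₂)] with x h1 h2
    exact ⟨h2, (hmaps ⟨hball h1.1, h1.2⟩).2⟩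
  have hAlim : Filter.Tendsto A (𝓝[U₁] 0) (𝓝 (A 0)) :=
    (hA 0 ⟨Metric.mem_ball_self hr, Or.inr h0S₁⟩).tendsto.mono_left
      (nhdsWithin_le_iff.2 (hev.mono fun x hx => ⟨hx.1, Or.inl hx.2⟩))
  have hBlim : Filter.Tendsto (fun x => B (Φ x)) (𝓝[U₁] 0) (𝓝 (B 0)) :=
    (hBc 0 ⟨Metric.mem_ball_self hr₂, Or.inr h0S₂⟩).tendsto.comp
      (tendsto_nhdsWithin_iff.2 ⟨hΦlim, hΦev.mono fun x hx => ⟨hx.1, Or.inl hx.2⟩⟩)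
  -- The chain rule is used only inside `U₁`, where `Ψ ∘ Φ` is the identity near each point; the
  -- identity at `0` is the limit.
  have hid : ∀ v, B 0 (A 0 v) = v := by
    intro v
    refine tendsto_nhds_unique (hBlim.continuousLinearMap_apply (hAlim.continuousLinearMap_apply tendsto_const_nhds)) ?_
    refine tendsto_const_nhds.congr' ?_
    filter_upwards [hev, hΦev] with x h1 h2
    have h3 := (hBd _ h2).comp x (hAd x h1)
    have h4 : HasFDerivAt (Ψ ∘ Φ) (ContinuousLinearMap.id ℝ E) x := by
      refine (hasFDerivAt_id x).congr_of_eventuallyEq ?_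
      filter_upwards [(hN₁.inter hU₁).mem_nhds ⟨hball h1.1, h1.2⟩] with y hy using hinv hy
    exact (congrArg (fun T : E →L[ℝ] E => T v) (h3.unique h4)).symm
  exact Function.LeftInverse.injective hid

theorem eventually_comparable_of_hasDerivAt {f : ℝ → ℂ} {d : ℂ} (hd : HasDerivAt f d 0)
    (h0 : f 0 = 0) (hne : d ≠ 0) :
    ∀ᶠ t : ℝ in 𝓝 (0 : ℝ), ‖d‖ / 2 * |t| ≤ ‖f t‖ ∧ ‖f t‖ ≤ 2 * ‖d‖ * |t| := by
  have hpos : 0 < ‖d‖ / 2 := by positivity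
  filter_upwards [(hasDerivAt_iff_isLittleO.1 hd).def hpos] with t ht
  simp only [h0, sub_zero, Real.norm_eq_abs] at ht
  have h1 : ‖(t • d : ℂ)‖ = |t| * ‖d‖ := by rw [norm_smul, Real.norm_eq_abs]
  have h2 := norm_sub_norm_le (t • d) (f t)
  rw [norm_sub_rev] at h2
  have h3 := norm_sub_norm_le (f t) (t • d)
  have := mul_nonneg (norm_nonneg d) (abs_nonneg t)
  constructor <;> nlinarith

-- The exponent is an invariant.

theorem exponent_eq_of_locallyEquivalent {n m : ℕ} (hn : 1 ≤ n) (hm : 1 ≤ m)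
    {D₁ D₂ U₁ U₂ : Set (ℂ × ℂ)}
    (h₁ : IsLeviFlatPair ∞ D₁ (hypersurfaceS n ∩ D₁) U₁)
    (h₂ : IsLeviFlatPair ∞ D₂ (hypersurfaceS m ∩ D₂) U₂)
    (heq : LocallyEquivalent ∞ (hypersurfaceS n ∩ D₁) U₁ (hypersurfaceS m ∩ D₂) U₂) :
    n = m := by
  obtain ⟨N₁, N₂, Φ, Ψ, hN₁, hN₂, h0N₁, h0N₂, hmaps, -, hinv, holΦ, holΨ, hΦ, hΨ, hΦS, -, hΦ0⟩ := heq
  obtain ⟨r₀, hr₀, σ, hσ, hside⟩ := exists_halfDisc_subset_side hn h₁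
  have hD₁ := h₁.isOpen_domain
  have h0S₁ := h₁.zero_mem
  obtain ⟨-, hU₁, -, -, -, -, -, hcl₁, -⟩ := h₁.divides
  obtain ⟨-, hU₂, -, -, -, -, -, hcl₂, -⟩ := h₂.divides
  have h1le : (1 : WithTop ℕ∞) ≤ ∞ := by simp
  obtain ⟨r₁, hr₁, hball, A, hAc, hAd, hAint, hAlin⟩ :=
    exists_boundary_derivative hN₁ hU₁ h0N₁ h0S₁ hcl₁ holΦ (hΦ.of_le h1le)
  have hinj : Function.Injective (A 0) :=
    boundary_derivative_injective hN₁ hN₂ hU₁ hU₂ h0N₁ h0N₂ h0S₁ h₂.zero_mem hcl₁ hcl₂ hmaps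
      hinv.1 holΨ (hΨ.of_le h1le) hΦ.continuousOn hΦ0 hr₁ hball hAc hAint
  set X := N₁ ∩ (U₁ ∪ hypersurfaceS n ∩ D₁) with hX
  set Y := Metric.ball 0 r₁ ∩ (U₁ ∪ hypersurfaceS n ∩ D₁) with hY
  have h0Y : (0 : ℂ × ℂ) ∈ Y := ⟨Metric.mem_ball_self hr₁, Or.inr h0S₁⟩
  -- the real line in the `w`-axis
  have hline : ∀ᶠ t : ℝ in 𝓝 (0 : ℝ), ((0, (t : ℂ)) : ℂ × ℂ) ∈
      Metric.ball (0 : ℂ × ℂ) r₁ ∩ (hypersurfaceS n ∩ D₁) := by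
    have hc : Continuous fun t : ℝ => ((0, (t : ℂ)) : ℂ × ℂ) := by fun_prop
    have h1 : (fun t : ℝ => ((0, (t : ℂ)) : ℂ × ℂ)) 0 ∈ Metric.ball (0 : ℂ × ℂ) r₁ ∩ D₁ :=
      ⟨Metric.mem_ball_self hr₁, h0S₁.2⟩
    filter_upwards [hc.continuousAt.preimage_mem_nhds
      ((Metric.isOpen_ball.inter hD₁).mem_nhds h1)] with t ht
    exact ⟨ht.1, ⟨t, by simp⟩, ht.2⟩
  have hlineY : ∀ᶠ t : ℝ in 𝓝 (0 : ℝ), ((0, (t : ℂ)) : ℂ × ℂ) ∈ Y :=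
    hline.mono fun t ht => ⟨ht.1, Or.inr ht.2⟩
  have hlinelim : Filter.Tendsto (fun t : ℝ => ((0, (t : ℂ)) : ℂ × ℂ)) (𝓝 0) (𝓝[Y] 0) := by
    refine tendsto_nhdsWithin_iff.2 ⟨?_, hlineY⟩
    have hc : Continuous fun t : ℝ => ((0, (t : ℂ)) : ℂ × ℂ) := by fun_prop
    exact hc.tendsto 0
  have hYX : Y ⊆ X := fun x hx => ⟨hball hx.1, hx.2⟩
  have hΦlim : Filter.Tendsto (fun t : ℝ => Φ (0, (t : ℂ))) (𝓝 0) (𝓝 0) := by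
    have h1 := (hΦ.continuousOn.mono hYX 0 h0Y).tendsto.comp hlinelim
    rwa [hΦ0] at h1
  have hAlim : Filter.Tendsto (fun t : ℝ => A (0, (t : ℂ))) (𝓝 0) (𝓝 (A 0)) :=
    (hAc 0 h0Y).tendsto.comp hlinelim
  have hglim : Filter.Tendsto (fun t : ℝ => ((flatSlope n t : ℝ) : ℂ)) (𝓝 0) (𝓝 0) := by
    have : Continuous fun t : ℝ => ((flatSlope n t : ℝ) : ℂ) :=
      Complex.continuous_ofReal.comp (contDiff_flatSlope hn).continuous
    simpa [flatSlope_zero] using this.tendsto 0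
  -- the derivative along the leaves
  have hsmall : ∀ᶠ t : ℝ in 𝓝 (0 : ℝ), 4 * (m : ℝ) * ‖(Φ (0, (t : ℂ))).1‖ < 1 / 2 := by
    have h1 : Filter.Tendsto (fun t : ℝ => 4 * (m : ℝ) * ‖(Φ (0, (t : ℂ))).1‖) (𝓝 0) (𝓝 0) := by
      simpa using ((continuous_fst.tendsto _).comp hΦlim).norm.const_mul (4 * (m : ℝ))
    exact h1.eventually_lt_const (by norm_num)
  have hleaf : ∀ᶠ t : ℝ in 𝓝 (0 : ℝ), ∃ τ : ℝ,
      (Φ (0, (t : ℂ))).2 = τ + flatSlope m τ * (Φ (0, (t : ℂ))).1 ∧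
      (A (0, (t : ℂ)) (1, (flatSlope n t : ℂ))).2 =
        flatSlope m τ * (A (0, (t : ℂ)) (1, (flatSlope n t : ℂ))).1 := by
    filter_upwards [hline, hsmall] with t ht hst
    have hγ : ∀ᶠ z in 𝓝 (0 : ℂ), ((z, t + flatSlope n t * z) : ℂ × ℂ) ∈
        N₁ ∩ (hypersurfaceS n ∩ D₁) := by
      have hc : Continuous fun z : ℂ => ((z, t + flatSlope n t * z) : ℂ × ℂ) := by fun_prop
      have h1 : (fun z : ℂ => ((z, t + flatSlope n t * z) : ℂ × ℂ)) 0 ∈ N₁ ∩ D₁ := by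
        simpa using And.intro (hball ht.1) ht.2.2
      filter_upwards [hc.continuousAt.preimage_mem_nhds ((hN₁.inter hD₁).mem_nhds h1)] with z hz
      exact ⟨hz.1, ⟨t, rfl⟩, hz.2⟩
    have htY : ((0, (t : ℂ)) : ℂ × ℂ) ∈ Y := ⟨ht.1, Or.inr ht.2⟩
    exact leaf_derivative_eq hm (X := X) (hγ.mono fun z hz => ⟨hz.1, Or.inr hz.2⟩)
      (hγ.mono fun z hz => (hΦS hz).2.1) (hAd _ htY) (hAlin _ htY) hst
  choose! τ hτ using fun (t : ℝ) (h : ∃ τ : ℝ,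
      (Φ (0, (t : ℂ))).2 = τ + flatSlope m τ * (Φ (0, (t : ℂ))).1 ∧
      (A (0, (t : ℂ)) (1, (flatSlope n t : ℂ))).2 =
        flatSlope m τ * (A (0, (t : ℂ)) (1, (flatSlope n t : ℂ))).1) => h
  replace hleaf := hleaf.mono hτ
  have hsplit : ∀ t : ℝ, ((0, (t : ℂ)) : ℂ × ℂ) ∈ Y → A (0, (t : ℂ)) (1, (flatSlope n t : ℂ)) =
      A (0, (t : ℂ)) (1, 0) + (flatSlope n t : ℂ) • A (0, (t : ℂ)) (0, 1) := by
    intro t ht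
    rw [← hAlin _ ht, ← map_add]
    simp
  -- the derivative at the origin
  have h00 : ((0, ((0 : ℝ) : ℂ)) : ℂ × ℂ) = 0 := rfl
  have hΦ00 : Φ (0, ((0 : ℝ) : ℂ)) = 0 := by rw [h00, hΦ0]
  -- The leaf through `0` is `w = 0` for both hypersurfaces, so its direction is preserved.
  have hG0 : (A 0 (1, 0)).2 = 0 := by
    obtain ⟨h1, h2⟩ := hleaf.self_of_nhds
    rw [hΦ00] at h1
    have h3 : τ 0 = 0 := by simpa using h1.symm
    rw [h00, h3] at h2
    simpa [flatSlope_zero] using h2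
  have hF0 : (A 0 (1, 0)).1 ≠ 0 := by
    intro h
    have h1 : A 0 (1, 0) = A 0 0 := by rw [map_zero]; exact Prod.ext h hG0
    simpa using congrArg Prod.fst (hinj h1)
  -- Otherwise `A 0` would map both basis vectors into the line `w = 0`, contradicting injectivity.
  have hd0 : (A 0 (0, 1)).2 ≠ 0 := by
    intro h
    have h1 : A 0 ((A 0 (0, 1)).1 • (1, 0) - (A 0 (1, 0)).1 • (0, 1)) = A 0 0 := by
      rw [map_sub, hAlin 0 h0Y, hAlin 0 h0Y, map_zero]
      refine Prod.ext ?_ ?_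
      · simp [mul_comm]
      · simp [hG0, h]
    simpa [hF0] using congrArg Prod.snd (hinj h1)
  -- comparison of `τ t` and `t`
  have hτt : ∃ α β : ℝ, 0 < α ∧ 0 < β ∧ ∀ᶠ t : ℝ in 𝓝 (0 : ℝ), α * |t| ≤ |τ t| ∧ |τ t| ≤ β * |t| := by
    have hderiv : HasDerivAt (fun t : ℝ => (Φ (0, (t : ℂ))).2) (A 0 (0, 1)).2 0 := by
      have hl : HasDerivAt (fun t : ℝ => ((0, (t : ℂ)) : ℂ × ℂ)) (0, 1) 0 :=
        (hasDerivAt_const (0 : ℝ) (0 : ℂ)).prodMk (Complex.ofRealCLM.hasDerivAt (x := (0 : ℝ)))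
      have hA0 : HasFDerivWithinAt Φ (A 0) X (0, ((0 : ℝ) : ℂ)) := hAd 0 h0Y
      have h1 : HasDerivWithinAt (Φ ∘ fun t : ℝ => ((0, (t : ℂ)) : ℂ × ℂ)) (A 0 (0, 1))
          ((fun t : ℝ => ((0, (t : ℂ)) : ℂ × ℂ)) ⁻¹' X) 0 :=
        hA0.comp_hasDerivWithinAt (0 : ℝ) hl.hasDerivWithinAt (Set.mapsTo_preimage _ _)
      have h2 := h1.hasDerivAt (hlineY.mono fun t ht => hYX ht)
      exact (ContinuousLinearMap.snd ℝ ℂ ℂ).hasFDerivAt.comp_hasDerivAt (0 : ℝ) h2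
    have hdpos : 0 < ‖(A 0 (0, 1)).2‖ := norm_pos_iff.2 hd0
    refine ⟨‖(A 0 (0, 1)).2‖ / 4, 4 * ‖(A 0 (0, 1)).2‖, by positivity, by positivity, ?_⟩
    filter_upwards [eventually_comparable_of_hasDerivAt hderiv (congrArg Prod.snd hΦ00) hd0, hleaf, hsmall]
      with t h1 h2 h3
    have h4 := abs_le_norm_of_mem_leaf hm h2.1 h3
    constructor <;> linarith [h1.1, h1.2, h4.1, h4.2]
  obtain ⟨α, β, hα, hβ, hτt⟩ := hτt
  -- bounds for the derivatives
  obtain ⟨K, hK0, hK⟩ : ∃ K : ℝ, 0 < K ∧ ∀ᶠ t : ℝ in 𝓝 (0 : ℝ), ‖A (0, (t : ℂ)) (1, 0)‖ ≤ K ∧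
      ‖A (0, (t : ℂ)) (0, 1)‖ ≤ K ∧ ‖A (0, (t : ℂ)) (1, (flatSlope n t : ℂ))‖ ≤ K := by
    have hlim : ∀ {v : ℝ → ℂ × ℂ} {v₀ : ℂ × ℂ}, Filter.Tendsto v (𝓝 0) (𝓝 v₀) →
        ∀ᶠ t : ℝ in 𝓝 (0 : ℝ), ‖A (0, (t : ℂ)) (v t)‖ < ‖A 0 v₀‖ + 1 := fun hv =>
      (hAlim.continuousLinearMap_apply hv).norm.eventually_lt_const (by linarith)
    have hpos := norm_nonneg (A 0 (1, 0))
    have hpos' := norm_nonneg (A 0 (0, 1))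
    refine ⟨‖A 0 (1, 0)‖ + ‖A 0 (0, 1)‖ + 1, by positivity, ?_⟩
    filter_upwards [hlim (tendsto_const_nhds (x := ((1, 0) : ℂ × ℂ))),
      hlim (tendsto_const_nhds (x := ((0, 1) : ℂ × ℂ))),
      hlim ((tendsto_const_nhds (x := (1 : ℂ))).prodMk_nhds hglim)] with t h1 h2 h3
    exact ⟨by linarith, by linarith, by linarith⟩
  obtain ⟨δ, hδ0, hδ⟩ : ∃ δ : ℝ, 0 < δ ∧ ∀ᶠ t : ℝ in 𝓝 (0 : ℝ), δ ≤ ‖(A (0, (t : ℂ)) (0, 1)).2‖ ∧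
      δ ≤ ‖(A (0, (t : ℂ)) (1, (flatSlope n t : ℂ))).1‖ := by
    have hp1 : 0 < ‖(A 0 (0, 1)).2‖ := norm_pos_iff.2 hd0
    have hp2 : 0 < ‖(A 0 (1, 0)).1‖ := norm_pos_iff.2 hF0
    refine ⟨min (‖(A 0 (0, 1)).2‖ / 2) (‖(A 0 (1, 0)).1‖ / 2), by positivity, ?_⟩
    have l1 := ((continuous_snd.tendsto _).comp
      (hAlim.continuousLinearMap_apply (tendsto_const_nhds (x := ((0, 1) : ℂ × ℂ))))).norm
    have l2 := ((continuous_fst.tendsto _).comp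
      (hAlim.continuousLinearMap_apply ((tendsto_const_nhds (x := (1 : ℂ))).prodMk_nhds hglim))).norm
    filter_upwards [l1.eventually_const_lt (half_lt_self hp1),
      l2.eventually_const_lt (half_lt_self hp2)] with t h1 h2
    exact ⟨(min_le_left _ _).trans h1.le, (min_le_right _ _).trans h2.le⟩
  -- the transversal component vanishes on the real line
  have hzero : ∀ᶠ t : ℝ in 𝓝 (0 : ℝ), (A (0, (t : ℂ)) (1, 0)).2 = 0 := by
    -- In the exponent, `1` comes from `g_n(t)` and `1/β²` from `g_m(τ)` with `|τ| ≤ β|t|`. Each of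
    -- the two terms contributes one factor `K`.
    have hflat : ∀ᶠ t : ℝ in 𝓝 (0 : ℝ), t ≠ 0 → ‖(A (0, (t : ℂ)) (1, 0)).2‖ ≤
        2 * K * Real.exp (-(min 1 (1 / β ^ 2)) / t ^ 2) := by
      have ht1 : ∀ᶠ t : ℝ in 𝓝 (0 : ℝ), |t| < 1 ∧ β * |t| < 1 := by
        have c1 : ContinuousAt (fun t : ℝ => |t|) 0 := by fun_prop
        have c2 : ContinuousAt (fun t : ℝ => β * |t|) 0 := by fun_prop
        exact (c1.eventually_lt_const (by simp)).and (c2.eventually_lt_const (by simp))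
      filter_upwards [ht1, hleaf, hτt, hK, hlineY] with t ⟨ht1, ht2⟩ ⟨_, hl⟩ ⟨hτ1, hτ2⟩
        ⟨_, hK2, hK3⟩ htY ht0
      have hτ0 : τ t ≠ 0 := abs_pos.1 (lt_of_lt_of_le (by positivity) hτ1)
      have ht2pos : 0 < t ^ 2 := by positivity
      have e1 : flatSlope n t ≤ Real.exp (-(min 1 (1 / β ^ 2)) / t ^ 2) := by
        refine (flatSlope_le_exp_neg_inv_sq hn ht0 ht1.le).trans (Real.exp_le_exp.2 ?_)
        gcongr
        exact min_le_left _ _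
      have e2 : flatSlope m (τ t) ≤ Real.exp (-(min 1 (1 / β ^ 2)) / t ^ 2) := by
        refine (flatSlope_le_exp_neg_inv_sq hm hτ0 (hτ2.trans ht2.le)).trans (Real.exp_le_exp.2 ?_)
        have h1 : τ t ^ 2 ≤ β ^ 2 * t ^ 2 := by
          rw [← sq_abs, ← sq_abs t, ← mul_pow]
          gcongr
        have h2 : 1 / (β ^ 2 * t ^ 2) ≤ 1 / τ t ^ 2 :=
          one_div_le_one_div_of_le (by positivity) h1
        have h3 : min 1 (1 / β ^ 2) / t ^ 2 ≤ 1 / (β ^ 2 * t ^ 2) := by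
          rw [← div_div]
          gcongr
          exact min_le_right _ _
        rw [neg_div, neg_div]
        linarith
      have e3 : (A (0, (t : ℂ)) (1, 0)).2 =
          flatSlope m (τ t) * (A (0, (t : ℂ)) (1, (flatSlope n t : ℂ))).1 -
            flatSlope n t * (A (0, (t : ℂ)) (0, 1)).2 := by
        rw [← hl, hsplit t htY]
        simp
      rw [e3]
      have n1 := (norm_fst_le (A (0, (t : ℂ)) (1, (flatSlope n t : ℂ)))).trans hK3
      have n2 := (norm_snd_le (A (0, (t : ℂ)) (0, 1))).trans hK2
      refine (norm_sub_le _ _).trans ?_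
      rw [norm_mul, norm_mul, Complex.norm_real, Complex.norm_real, Real.norm_eq_abs,
        Real.norm_eq_abs, abs_of_nonneg (flatSlope_nonneg n t),
        abs_of_nonneg (flatSlope_nonneg m (τ t))]
      have p1 := mul_le_mul e2 n1 (norm_nonneg _) (Real.exp_pos _).le
      have p2 := mul_le_mul e1 n2 (norm_nonneg _) (Real.exp_pos _).le
      linarith
    obtain ⟨ε, hε, hεflat⟩ := Metric.eventually_nhds_iff.1 (hflat.and hline)
    set r := min (min r₀ r₁) ε / 2 with hr
    have hr0 : 0 < r := by positivity
    have hrr₀ : r < r₀ := by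
      have := (min_le_left (min r₀ r₁) ε).trans (min_le_left r₀ r₁); linarith
    have hrr₁ : r < r₁ := by
      have := (min_le_left (min r₀ r₁) ε).trans (min_le_right r₀ r₁); linarith
    have hrε : r < ε := by have := min_le_right (min r₀ r₁) ε; linarith
    have hσ2 : (σ : ℂ) * σ = 1 := by rcases hσ with rfl | rfl <;> simp
    have hσn : ∀ w : ℂ, ‖(σ : ℂ) * w‖ = ‖w‖ := by rcases hσ with rfl | rfl <;> simp
    have hσi : ∀ w : ℂ, σ * ((σ : ℂ) * w).im = w.im := by rcases hσ with rfl | rfl <;> simp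
    have hmemU : ∀ w ∈ upperHalfDisc r, ((0, σ * w) : ℂ × ℂ) ∈ Metric.ball 0 r₁ ∩ U₁ := by
      rintro w ⟨hw1, hw2⟩
      refine ⟨?_, hside _ (by rw [hσn]; linarith) (by rwa [hσi])⟩
      rw [mem_ball_zero_iff, Prod.norm_def, max_lt_iff, hσn]
      exact ⟨by simpa using hr₁, by linarith⟩
    have hreal : ∀ x : ℝ, |x| ≤ r → dist x 0 < ε := fun x hx => by
      rw [Real.dist_eq, sub_zero]; linarith
    have hσreal : ∀ x : ℝ, (σ : ℂ) * x = ((σ * x : ℝ) : ℂ) := fun x => by push_cast; rfl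
    have hσabs : ∀ x : ℝ, |σ * x| = |x| := by rcases hσ with rfl | rfl <;> simp
    -- Multiplication by `σ = ±1` carries the upper half disc to the half that lies in `U₁`.
    set f : ℂ → ℂ := fun w => (A (0, σ * w) (1, 0)).2 with hf
    have hγd : ∀ w : ℂ, DifferentiableAt ℂ (fun w : ℂ => ((0, σ * w) : ℂ × ℂ)) w := fun w => by
      fun_prop
    have hfd : DifferentiableOn ℂ f (upperHalfDisc r) := by
      intro w hw
      have hopen : IsOpen (Metric.ball (0 : ℂ × ℂ) r₁ ∩ U₁) := Metric.isOpen_ball.inter hU₁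
      have hsub : Metric.ball (0 : ℂ × ℂ) r₁ ∩ U₁ ⊆ N₁ ∩ U₁ := fun x hx => ⟨hball hx.1, hx.2⟩
      have h1 : DifferentiableAt ℂ (fun y => fderiv ℝ Φ y (1, 0)) ((0, σ * w) : ℂ × ℂ) :=
        ContDiffOn.differentiableAt_fderiv_apply_complex hopen
          ((hΦ.of_le (by norm_cast)).mono fun x hx => ⟨hball hx.1, Or.inl hx.2⟩)
          (holΦ.mono hsub) (hmemU w hw) _
      have h2 : DifferentiableAt ℂ (fun y => A y (1, 0)) ((0, σ * w) : ℂ × ℂ) := by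
        refine h1.congr_of_eventuallyEq ?_
        filter_upwards [hopen.mem_nhds (hmemU w hw)] with y hy
        rw [(hAint y hy).fderiv]
      exact (differentiableAt_snd.comp w
        (DifferentiableAt.comp w (g := fun y => A y (1, 0)) h2 (hγd w))).differentiableWithinAt
    have hfc : ContinuousOn f {w | 0 ≤ w.im ∧ ‖w‖ ≤ r} := by
      have h1 : ContinuousOn (fun w : ℂ => A (0, σ * w)) {w | 0 ≤ w.im ∧ ‖w‖ ≤ r} := by
        refine hAc.comp (fun w _ => (hγd w).continuousAt.continuousWithinAt) ?_
        rintro w ⟨hw1, hw2⟩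
        have hwb : ((0, σ * w) : ℂ × ℂ) ∈ Metric.ball (0 : ℂ × ℂ) r₁ := by
          rw [mem_ball_zero_iff, Prod.norm_def, max_lt_iff, hσn]
          exact ⟨by simpa using hr₁, by linarith⟩
        refine ⟨hwb, ?_⟩
        rcases hw1.lt_or_eq with hpos | hz
        · exact Or.inl (hside _ (by rw [hσn]; linarith) (by rwa [hσi]))
        · have hwre : w = (w.re : ℂ) := by apply Complex.ext <;> simp [← hz]
          have hwa : |σ * w.re| ≤ r := by rw [hσabs]; exact (Complex.abs_re_le_norm w).trans hw2
          have := (hεflat (hreal _ hwa)).2.2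
          rw [hwre]
          dsimp only
          rw [hσreal]
          exact Or.inr this
      exact continuous_snd.comp_continuousOn (h1.clm_apply continuousOn_const)
    have hf0 : f 0 = 0 := by simp only [hf, mul_zero]; exact hG0
    have hff : ∀ x : ℝ, x ≠ 0 → |x| ≤ r → ‖f x‖ ≤
        2 * K * Real.exp (-(min 1 (1 / β ^ 2)) / x ^ 2) := by
      intro x hx0 hxr
      have hσ0 : σ ≠ 0 := by rcases hσ with rfl | rfl <;> norm_num
      have h1 := (hεflat (hreal (σ * x) (by rwa [hσabs]))).1 (mul_ne_zero hσ0 hx0)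
      rw [← sq_abs (σ * x), hσabs, sq_abs] at h1
      simpa [hf] using h1
    have hvan : ∀ x : ℝ, |x| < r → f x = 0 := fun x hx =>
      eq_zero_on_diameter_of_flat_boundary_values hr0 (by positivity) hfd hfc hf0 hff hx
    filter_upwards [Metric.ball_mem_nhds (0 : ℝ) hr0] with t ht
    have h1 := hvan (σ * t) (by rw [hσabs]; simpa using ht)
    simp only [hf, Complex.ofReal_mul, ← mul_assoc, hσ2, one_mul] at h1
    exact h1
  -- conclusion
  refine exponent_eq_of_flatSlope_comparable hα (C := K / δ) (β := β) (by positivity) ?_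
  refine Filter.Eventually.filter_mono nhdsWithin_le_nhds ?_
  filter_upwards [hzero, hleaf, hτt, hK, hδ, hlineY]
    with t h0 ⟨_, hl⟩ ⟨hτ1, hτ2⟩ ⟨_, hK2, hK3⟩ ⟨hδ1, hδ2⟩ htY
  refine ⟨τ t, hτ1, hτ2, ?_⟩
  -- With the transversal term gone, the tangency relation is an exact equality. The bounds `δ` and
  -- `K` on its two factors turn it into comparability with constant `K / δ`.
  have key : flatSlope n t * ‖(A (0, (t : ℂ)) (0, 1)).2‖ =
      flatSlope m (τ t) * ‖(A (0, (t : ℂ)) (1, (flatSlope n t : ℂ))).1‖ := by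
    have h1 : (flatSlope n t : ℂ) * (A (0, (t : ℂ)) (0, 1)).2 =
        flatSlope m (τ t) * (A (0, (t : ℂ)) (1, (flatSlope n t : ℂ))).1 := by
      rw [← hl, hsplit t htY]
      simp [h0]
    have h2 := congrArg norm h1
    rwa [norm_mul, norm_mul, Complex.norm_real, Complex.norm_real, Real.norm_eq_abs,
      Real.norm_eq_abs, abs_of_nonneg (flatSlope_nonneg n t),
      abs_of_nonneg (flatSlope_nonneg m (τ t))] at h2
  have n1 := (norm_fst_le (A (0, (t : ℂ)) (1, (flatSlope n t : ℂ)))).trans hK3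
  have n2 := (norm_snd_le (A (0, (t : ℂ)) (0, 1))).trans hK2
  have g0 := flatSlope_nonneg n t
  have g1 := flatSlope_nonneg m (τ t)
  constructor
  · rw [div_mul_eq_mul_div, le_div_iff₀ hδ0]
    nlinarith [mul_le_mul_of_nonneg_left hδ1 g0, mul_le_mul_of_nonneg_left n1 g1]
  · rw [div_mul_eq_mul_div, le_div_iff₀ hδ0]
    nlinarith [mul_le_mul_of_nonneg_left hδ2 g1, mul_le_mul_of_nonneg_left n2 g0]

theorem mainTheorem7 :
    (∀ n : ℕ, 1 ≤ n → ∀ N ∈ 𝓝 (0 : ℂ × ℂ), ∃ D ⊆ N,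
      (∃ U : Set (ℂ × ℂ), IsLeviFlatPair ∞ D (hypersurfaceS n ∩ D) U) ∧
      IsRealHypersurface ω ((hypersurfaceS n ∩ D) \ {p : ℂ × ℂ | p.2 = 0})) ∧
    (∀ n m : ℕ, 1 ≤ n → 1 ≤ m → n ≠ m → ∀ D U₁ U₂ : Set (ℂ × ℂ),
      IsLeviFlatPair ∞ D (hypersurfaceS n ∩ D) U₁ →
      IsLeviFlatPair ∞ D (hypersurfaceS m ∩ D) U₂ →
      ¬ LocallyEquivalent ∞ (hypersurfaceS n ∩ D) U₁ (hypersurfaceS m ∩ D) U₂) :=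
  ⟨fun _ hn _ hN => exists_leviFlatPair_domain hn hN,
    fun _ _ hn hm hnm _ _ _ h₁ h₂ heq => hnm (exponent_eq_of_locallyEquivalent hn hm h₁ h₂ heq)⟩
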